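/- Let $P\subset\mathbb{R}^3$ be a $3$-dimensional lattice polytope, i.e. the convex hull of finitely many points of $\mathbb{Z}^3$ that is not contained in a plane. Suppose that $P$ is smooth, i.e. $P$ is simple (every vertex lies on exactly three edges) and at every vertex the primitive integer vectors in the directions of the edges form a basis of the lattice $\mathbb{Z}^3$; and suppose that $P$ is a prismatoid, i.e. $P$ has two distinct parallel facets that together contain all vertices of $P$. Then $P$ has a unimodular cover: there is a finite collection of unimodular simplices whose union equals $P$. Here a unimodular simplex is the convex hull of four points $v_0,v_1,v_2,v_3\in\mathbb{Z}^3$ such that $v_1-v_0,\ v_2-v_0,\ v_3-v_0$ form a basis of $\mathbb{Z}^3$. -/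

import Mathlib

/-- The point of `ℝ^d` with the integer coordinates `v`. -/
def latticePoint {d : ℕ} (v : Fin d → ℤ) : Fin d → ℝ := fun i => (v i : ℝ)

/-- A lattice polytope in `ℝ^d`: the convex hull of a finite nonempty set of points of `ℤ^d`. -/
def IsLatticePolytope {d : ℕ} (P : Set (Fin d → ℝ)) : Prop :=
  ∃ V : Set (Fin d → ℤ), V.Finite ∧ V.Nonempty ∧ P = convexHull ℝ (latticePoint '' V)

/-- The dimension of a (nonempty) set in `ℝ^d`, that is, the dimension of its affine span. -/
noncomputable def polytopeDim {d : ℕ} (P : Set (Fin d → ℝ)) : ℕ :=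
  Module.finrank ℝ (vectorSpan ℝ P)

/-- `F` is a `k`-dimensional face of `P`: the nonempty set of maximizers over `P` of some linear
functional, of dimension `k`. -/
def IsFaceOfDim {d : ℕ} (k : ℕ) (P F : Set (Fin d → ℝ)) : Prop :=
  F.Nonempty ∧ IsExposed ℝ P F ∧ polytopeDim F = k

/-- Facets: the faces of codimension one. -/
def IsFacet {d : ℕ} (P F : Set (Fin d → ℝ)) : Prop :=
  ∃ k : ℕ, polytopeDim P = k + 1 ∧ IsFaceOfDim k P F

/-- Edges: the faces of dimension one. -/
def IsEdge {d : ℕ} (P E : Set (Fin d → ℝ)) : Prop := IsFaceOfDim 1 P E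

/-- A polytope is simple if every vertex lies on exactly `dim P` edges. -/
def IsSimplePolytope {d : ℕ} (P : Set (Fin d → ℝ)) : Prop :=
  ∀ v ∈ Set.extremePoints ℝ P, {E | IsEdge P E ∧ v ∈ E}.encard = (polytopeDim P : ℕ∞)

/-- The primitive edge directions of `P` at the vertex `v`: the primitive integer vectors (the gcd
of the coordinates is one) pointing from `v` along an edge of `P`. -/
def primitiveEdgeDirections {d : ℕ} (P : Set (Fin d → ℝ)) (v : Fin d → ℝ) : Set (Fin d → ℤ) :=
  {u | Finset.univ.gcd u = 1 ∧
    ∃ E, IsEdge P E ∧ v ∈ E ∧ ∃ t : ℝ, 0 < t ∧ v + t • latticePoint u ∈ E}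

/-- A smooth polytope in `ℝ^d`: it is simple and the primitive edge directions at each vertex form
a basis of the lattice `ℤ^d`. -/
def IsSmoothPolytope {d : ℕ} (P : Set (Fin d → ℝ)) : Prop :=
  IsSimplePolytope P ∧ ∀ v ∈ Set.extremePoints ℝ P,
    LinearIndepOn ℤ id (primitiveEdgeDirections P v) ∧
      Submodule.span ℤ (primitiveEdgeDirections P v) = ⊤

/-- A prismatoid: all vertices lie in two (distinct) parallel facets. -/
def IsPrismatoid {d : ℕ} (P : Set (Fin d → ℝ)) : Prop :=
  ∃ F G : Set (Fin d → ℝ), IsFacet P F ∧ IsFacet P G ∧ F ≠ G ∧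
    (affineSpan ℝ F).Parallel (affineSpan ℝ G) ∧ Set.extremePoints ℝ P ⊆ F ∪ G

/-- A unimodular simplex in `ℝ^d`: the convex hull of `d + 1` lattice points `v 0, …, v d` for which
the vectors `v i - v 0` form a basis of `ℤ^d`, that is, have determinant `1` or `-1`. -/
def IsUnimodularSimplex {d : ℕ} (T : Set (Fin d → ℝ)) : Prop :=
  ∃ v : Fin (d + 1) → Fin d → ℤ,
    IsUnit (Matrix.of fun i j : Fin d => v i.succ j - v 0 j).det ∧
      T = convexHull ℝ (Set.range fun i => latticePoint (v i))

/-- `P` has a unimodular cover: it is the union of a finite collection of unimodular simplices. -/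
def HasUnimodularCover {d : ℕ} (P : Set (Fin d → ℝ)) : Prop :=
  ∃ C : Set (Set (Fin d → ℝ)), C.Finite ∧ (∀ T ∈ C, IsUnimodularSimplex T) ∧ ⋃₀ C = P

/-! After a unimodular change of coordinates the bottom facet lies at height 0 and the top one at
height `N`. Smoothness gives at each bottom vertex `v` a lattice basis: two vectors along the bottom
facet and one, of height 1, along the edge rising from `v`. That edge ends at height `N`, since no
vertex lies in between. Hence every integer slice is a lattice polygon, and the slab between two
consecutive ones is the hull of the lattice points at its two levels (`PrismData.mem_convexHull`).
The lattice length of a side is integral and affine in the height, and positive below the top, so at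
least 1 there (`PrismData.side_edge_mem`). Thus each edge of the slice at height k + 1 is parallel
to a lattice segment in an edge of the slice at height k (`SlabRefines`).

A point of a slab lies in a nondegenerate lattice tetrahedron with vertices on the two levels. If
its normalized volume is at least 2, one looks for a lattice point r on these levels with all
barycentric coordinates less than 1. Exchanging r for a suitable vertex of positive coordinate μ
keeps the given point inside and multiplies the volume by μ < 1 (`exists_pivot`, `tetraDet_update`),
so descent ends at a unimodular tetrahedron. Only finitely many occur, as `P` is bounded.

If three vertices share a level, r comes from a lattice triangle. The hard case has an edge u below
and an edge v above. In coordinates along u and v, failure means that the lower slice A has no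
lattice point with 0 < x < 1 and the upper slice B none with 0 < y < 1. The right edge of B across
its strip has a parallel lattice segment in an edge of A, which forces a vertical unit segment in A
at some x ≥ 1 (`StripFreePair.exists_vertical_unit_of_edges`). By reflection there is another at
some x ≤ 0. By convexity A then has unit vertical segments over the whole strip, hence a lattice
point in it: a contradiction (`StripFreePair.not_faceRefines`). -/

/-! ### Convex subsets of the plane in coordinates. -/

theorem Convex.prodMk_mem_of_mem_segment {A : Set (ℝ × ℝ)} (hA : Convex ℝ A) {x₁ y₁ x₂ y₂ s : ℝ}
    (h₁ : (x₁, y₁) ∈ A) (h₂ : (x₂, y₂) ∈ A) (hs : 0 ≤ s) (hs' : s ≤ 1) :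
    (x₁ + s * (x₂ - x₁), y₁ + s * (y₂ - y₁)) ∈ A := by
  have h := hA h₁ h₂ (sub_nonneg.2 hs') hs (by ring)
  convert h using 1
  ext <;> simp <;> ring

theorem Convex.prodMk_mem_of_vertical {A : Set (ℝ × ℝ)} (hA : Convex ℝ A) {x y₁ y₂ y : ℝ}
    (h₁ : (x, y₁) ∈ A) (h₂ : (x, y₂) ∈ A) (hy : y₁ ≤ y) (hy' : y ≤ y₂) : (x, y) ∈ A := by
  rcases eq_or_lt_of_le (hy.trans hy') with h | h
  · obtain rfl : y = y₁ := le_antisymm (h ▸ hy') hy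
    exact h₁
  · have h0 : 0 < y₂ - y₁ := sub_pos.2 h
    have := hA.prodMk_mem_of_mem_segment h₁ h₂ (s := (y - y₁) / (y₂ - y₁))
      (div_nonneg (by linarith) h0.le) ((div_le_one h0).2 (by linarith))
    convert this using 2
    · ring
    · field_simp; ring

theorem Convex.prodMk_mem_of_horizontal {A : Set (ℝ × ℝ)} (hA : Convex ℝ A) {y x₁ x₂ x : ℝ}
    (h₁ : (x₁, y) ∈ A) (h₂ : (x₂, y) ∈ A) (hx : x₁ ≤ x) (hx' : x ≤ x₂) : (x, y) ∈ A := by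
  rcases eq_or_lt_of_le (hx.trans hx') with h | h
  · obtain rfl : x = x₁ := le_antisymm (h ▸ hx') hx
    exact h₁
  · have h0 : 0 < x₂ - x₁ := sub_pos.2 h
    have := hA.prodMk_mem_of_mem_segment h₁ h₂ (s := (x - x₁) / (x₂ - x₁))
      (div_nonneg (by linarith) h0.le) ((div_le_one h0).2 (by linarith))
    convert this using 2
    · field_simp; ring
    · ring

/-- The point at abscissa `x` on the line through `(x₁, y₁)` and `(x₂, y₂)`. -/
theorem Convex.prodMk_mem_of_abscissa {A : Set (ℝ × ℝ)} (hA : Convex ℝ A) {x₁ y₁ x₂ y₂ x : ℝ}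
    (h₁ : (x₁, y₁) ∈ A) (h₂ : (x₂, y₂) ∈ A) (h : x₁ < x₂) (hx : x₁ ≤ x) (hx' : x ≤ x₂) :
    (x, y₁ + (x - x₁) * ((y₂ - y₁) / (x₂ - x₁))) ∈ A := by
  have h0 : 0 < x₂ - x₁ := sub_pos.2 h
  have := hA.prodMk_mem_of_mem_segment h₁ h₂ (s := (x - x₁) / (x₂ - x₁))
      (div_nonneg (by linarith) h0.le) ((div_le_one h0).2 (by linarith))
  convert this using 2
  · field_simp; ring
  · ring

theorem Convex.prodMk_mem_of_ordinate {A : Set (ℝ × ℝ)} (hA : Convex ℝ A) {x₁ y₁ x₂ y₂ y : ℝ}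
    (h₁ : (x₁, y₁) ∈ A) (h₂ : (x₂, y₂) ∈ A) (h : y₁ < y₂) (hy : y₁ ≤ y) (hy' : y ≤ y₂) :
    (x₁ + (y - y₁) * ((x₂ - x₁) / (y₂ - y₁)), y) ∈ A := by
  have h0 : 0 < y₂ - y₁ := sub_pos.2 h
  have := hA.prodMk_mem_of_mem_segment h₁ h₂ (s := (y - y₁) / (y₂ - y₁))
      (div_nonneg (by linarith) h0.le) ((div_le_one h0).2 (by linarith))
  convert this using 2
  · ring
  · field_simp; ring

/-! ### The planar core: strip-free pairs and parallel edges. -/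

/-- A pair of convex sets in the plane containing the unit segments on the two axes, whose points
in a lattice `L` avoid the open unit strips over these segments; the lattice has points inside the
unit square. -/
structure StripFreePair (L : AddSubgroup (ℝ × ℝ)) (A B : Set (ℝ × ℝ)) : Prop where
  convex_left : Convex ℝ A
  convex_right : Convex ℝ B
  one_zero_mem : ((1 : ℝ), (0 : ℝ)) ∈ L
  zero_one_mem : ((0 : ℝ), (1 : ℝ)) ∈ L
  exists_mem : ∃ x y, (x, y) ∈ L ∧ 0 < x ∧ x < 1 ∧ 0 < y ∧ y < 1
  left_zero : ((0 : ℝ), (0 : ℝ)) ∈ A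
  left_one : ((1 : ℝ), (0 : ℝ)) ∈ A
  right_zero : ((0 : ℝ), (0 : ℝ)) ∈ B
  right_one : ((0 : ℝ), (1 : ℝ)) ∈ B
  left_free : ∀ x y, (x, y) ∈ L → (x, y) ∈ A → 0 < x → 1 ≤ x
  right_free : ∀ x y, (x, y) ∈ L → (x, y) ∈ B → 0 < y → 1 ≤ y

/-- Lattice segments in direction `(a, b)` contained in the faces of `B` and `A` with outer normal
`(b, -a)`, the one in `B` crossing the unit strip. -/
structure ParallelEdges (L : AddSubgroup (ℝ × ℝ)) (A B : Set (ℝ × ℝ)) (a b q₁ q₂ p₁ p₂ : ℝ) :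
    Prop where
  dir_mem : (a, b) ∈ L
  le_zero : q₂ ≤ 0
  one_le : 1 ≤ q₂ + b
  right_start : (q₁, q₂) ∈ B
  right_end : (q₁ + a, q₂ + b) ∈ B
  right_max : ∀ x y, (x, y) ∈ B → b * x - a * y ≤ b * q₁ - a * q₂
  left_mem : (p₁, p₂) ∈ L
  left_start : (p₁, p₂) ∈ A
  left_end : (p₁ + a, p₂ + b) ∈ A
  left_max : ∀ x y, (x, y) ∈ A → b * x - a * y ≤ b * p₁ - a * p₂

/-- The chord of `A` from the origin to the far end of its edge passes above the start of the edge.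
Were the vertical gap there less than 1, a translate of `(a, b)` by multiples of `(1, 1)` and `(0,
1)` would fall into one of the two strips. -/
theorem StripFreePair.exists_vertical_unit_of_pos {L : AddSubgroup (ℝ × ℝ)} {A B : Set (ℝ × ℝ)}
    (h : StripFreePair L A B) {a b q₁ q₂ p₁ p₂ : ℝ} (he : ParallelEdges L A B a b q₁ q₂ p₁ p₂)
    (ha : 0 < a) : 1 ≤ p₁ ∧ (p₁, p₂ + 1) ∈ A := by
  obtain ⟨hA, hB, hL₁, hL₂, hg, hA₀, hA₁, hB₀, hB₁, hAL, hBL⟩ := h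
  obtain ⟨hab, hq₂, hqb, hQ, hR, hBmax, hpL, hP, hT, hAmax⟩ := he
  -- The half-turn about the centre of the unit square preserves `L`, so the lattice point may be
  -- taken on or below the diagonal.
  obtain ⟨g₁, g₂, hg, hg₂, hg₁₂, hg₁⟩ :
      ∃ g₁ g₂, (g₁, g₂) ∈ L ∧ 0 < g₂ ∧ g₂ ≤ g₁ ∧ g₁ < 1 := by
    obtain ⟨x, y, hxy, hx, hx', hy, hy'⟩ := hg
    rcases le_total y x with h | h
    · exact ⟨x, y, hxy, hy, h, hx'⟩
    · refine ⟨1 - x, 1 - y, ?_, by linarith, by linarith, by linarith⟩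
      have := L.sub_mem (L.add_mem hL₁ hL₂) hxy
      simpa using this
  have hb : 1 ≤ b := by linarith
  have hb0 : 0 < b := by linarith
  -- As `B` contains the origin, its edge runs on or to the right of the line through the origin in
  -- direction `(a, b)`.
  have hedge : ∀ y, 0 ≤ y → y ≤ 1 → ∃ x, (x, y) ∈ B ∧ a * y ≤ b * x := by
    intro y hy hy'
    refine ⟨_, hB.prodMk_mem_of_ordinate hQ hR (by linarith) (hq₂.trans hy) (hy'.trans hqb), ?_⟩
    have h0 := hBmax 0 0 hB₀
    have : b * (q₁ + (y - q₂) * ((q₁ + a - q₁) / (q₂ + b - q₂))) = b * q₁ + (y - q₂) * a := by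
      rw [show q₁ + a - q₁ = a by ring, show q₂ + b - q₂ = b by ring]
      field_simp
    rw [this]
    linarith
  have hleft : ∀ y, 0 ≤ y → y ≤ 1 → ((0 : ℝ), y) ∈ B := fun y hy hy' =>
    hB.prodMk_mem_of_vertical hB₀ hB₁ hy hy'
  have hbase : ∀ x, 0 ≤ x → x ≤ 1 → (x, (0 : ℝ)) ∈ A := fun y hy hy' =>
    hA.prodMk_mem_of_horizontal hA₀ hA₁ hy hy'
  have hg0 : 0 < g₁ := hg₂.trans_le hg₁₂
  have hgc : (1 - g₁, 1 - g₂) ∈ L := by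
    have := L.sub_mem (L.add_mem hL₁ hL₂) hg
    simpa using this
  have hgr : (1 - g₁, - g₂) ∈ L := by
    have := L.sub_mem hL₁ hg
    simpa using this
  -- the slope of the edge of `B`
  have hab' : a < b := by
    by_contra! hba
    obtain ⟨x, hx, hax⟩ := hedge 1 zero_le_one le_rfl
    have hx1 : 1 ≤ x := by
      by_contra! hx1
      nlinarith
    -- If `b ≤ a`, then `B` contains the triangle (0,0), (0,1), (1,1), and with it the lattice point
    -- `(1 - g₁, 1 - g₂)` of the strip.
    have h1 : (1 - g₂, 1 - g₂) ∈ B := by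
      have := hB.prodMk_mem_of_mem_segment hB₀
        (hB.prodMk_mem_of_horizontal hB₁ hx zero_le_one hx1) (s := 1 - g₂) (by linarith) (by linarith)
      simpa using this
    have h2 := hB.prodMk_mem_of_horizontal (hleft (1 - g₂) (by linarith) (by linarith)) h1
      (x := 1 - g₁) (by linarith) (by linarith)
    have := hBL _ _ hgc h2 (by linarith)
    linarith
  -- Otherwise the triangle on (0,0), (1,0), (x,y) contains `(g₁, g₂)`; in the next claim it would
  -- contain `(1 - g₁, -g₂)`.
  have hslope : ∀ x y, (x, y) ∈ A → 1 ≤ x → y < x := by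
    intro x y hxy hx
    by_contra! hyx
    have h1 : (g₁, 0 + (g₁ - 0) * ((y - 0) / (x - 0))) ∈ A :=
      hA.prodMk_mem_of_abscissa hA₀ hxy (by linarith) hg0.le (by linarith)
    have h2 : g₂ ≤ 0 + (g₁ - 0) * ((y - 0) / (x - 0)) := by
      have : 1 ≤ y / x := (one_le_div (by linarith)).2 hyx
      simp only [sub_zero, zero_add]
      nlinarith
    have := hAL _ _ hg (hA.prodMk_mem_of_vertical (hbase g₁ hg0.le hg₁.le) h1 hg₂.le h2) hg0
    linarith
  have hslope' : ∀ x y, (x, y) ∈ A → x ≤ 0 → -y < 1 - x := by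
    intro x y hxy hx
    by_contra! hyx
    have h1 := hA.prodMk_mem_of_abscissa hxy hA₁ (by linarith) (x := 1 - g₁) (by linarith)
      (by linarith)
    have h2 : y + (1 - g₁ - x) * ((0 - y) / (1 - x)) ≤ - g₂ := by
      have : 1 ≤ -y / (1 - x) := (one_le_div (by linarith)).2 hyx
      have h3 : y + (1 - g₁ - x) * ((0 - y) / (1 - x)) = - (g₁ * (-y / (1 - x))) := by
        have : 1 - x ≠ 0 := by linarith
        field_simp
        ring
      rw [h3]
      nlinarith
    have := hAL _ _ hgr (hA.prodMk_mem_of_vertical h1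
      (hbase (1 - g₁) (by linarith) (by linarith)) h2 (by linarith)) (by linarith)
    linarith
  -- For `p₁ ≤ 0`, maximality at the edge against (1,0) gives `b (1 - p₁) ≤ -a p₂`, contradicting
  -- `-p₂ < 1 - p₁` and `a < b`.
  have hp1 : 1 ≤ p₁ := by
    refine hAL _ _ hpL hP ?_
    by_contra! hp
    have h1 := hslope' _ _ hP hp
    have h2 := hAmax 1 0 hA₁
    nlinarith
  refine ⟨hp1, ?_⟩
  -- The slope of the chord from the origin to the far end of the edge; at abscissa `p₁` the chord
  -- is `b - σ * a` above `p₂`.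
  set σ := (p₂ + b) / (p₁ + a) with hσ
  have hpa : 0 < p₁ + a := by linarith
  have hσ1 : σ < 1 := (div_lt_one hpa).2 (hslope _ _ hT (by linarith))
  have hray : ∀ x, 0 ≤ x → x ≤ p₁ + a → (x, σ * x) ∈ A := by
    intro x hx hx'
    have := hA.prodMk_mem_of_abscissa hA₀ hT hpa hx hx'
    convert this using 2
    rw [hσ]
    simp
    ring
  suffices h : 1 ≤ b - σ * a by
    refine hA.prodMk_mem_of_vertical hP (hray p₁ (by linarith) (by linarith)) (by linarith) ?_
    have : σ * (p₁ + a) = p₂ + b := div_mul_cancel₀ _ hpa.ne'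
    linarith
  by_contra! hlt
  have hba : b < a + 1 := by
    by_contra! hba
    nlinarith
  have hf0 : (0 : ℤ) ≤ ⌊a⌋ := Int.floor_nonneg.2 ha.le
  have hf0' : (0 : ℝ) ≤ (⌊a⌋ : ℝ) := by exact_mod_cast hf0
  have hfa : (⌊a⌋ : ℝ) ≤ a := Int.floor_le a
  have hfa' : a < ⌊a⌋ + 1 := Int.lt_floor_add_one a
  -- If the ordinate is below 1, this point lies in the strip of `B`, left of the edge. Otherwise,
  -- lowered by 1, it lies in the strip of `A`, under the chord.
  have hr : (a - ⌊a⌋, b - ⌊a⌋) ∈ L := by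
    have := L.sub_mem hab (L.zsmul_mem (L.add_mem hL₁ hL₂) ⌊a⌋)
    simpa using this
  rcases lt_or_ge (b - ⌊a⌋) 1 with hbf | hbf
  · obtain ⟨x, hx, hax⟩ := hedge (b - ⌊a⌋) (by linarith) hbf.le
    have h1 : a - ⌊a⌋ ≤ x := by
      by_contra! h
      nlinarith
    have := hBL _ _ hr (hB.prodMk_mem_of_horizontal (hleft _ (by linarith) hbf.le) hx
      (by linarith) h1) (by linarith)
    linarith
  · have hfne : 0 < a - ⌊a⌋ := by
      rcases eq_or_lt_of_le (sub_nonneg.2 hfa) with h | h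
      · rw [← h] at hr
        linarith
      · exact h
    have hr' : (a - ⌊a⌋, b - ⌊a⌋ - 1) ∈ L := by
      have := L.sub_mem hr hL₂
      simpa using this
    have := hAL _ _ hr' (hA.prodMk_mem_of_vertical (hbase _ hfne.le (by linarith))
      (hray _ hfne.le (by linarith)) (by linarith) (by nlinarith)) hfne
    linarith

/-! ### Reflections of strip-free pairs. -/

theorem Convex.preimage_prod_affine {A : Set (ℝ × ℝ)} (hA : Convex ℝ A) (c d s t : ℝ) :
    Convex ℝ {z : ℝ × ℝ | (c + s * z.1, d + t * z.2) ∈ A} := by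
  intro x hx y hy α β hα hβ hαβ
  have h := hA hx hy hα hβ hαβ
  simp only [Set.mem_ofPred_eq] at h ⊢
  convert h using 1
  ext
  · simp only [Prod.smul_mk, Prod.mk_add_mk, Prod.fst_add, Prod.smul_fst, smul_eq_mul]
    linear_combination (-c) * hαβ
  · simp only [Prod.smul_mk, Prod.mk_add_mk, Prod.snd_add, Prod.smul_snd, smul_eq_mul]
    linear_combination (-d) * hαβ

/-- The linear map scaling the two coordinates of the plane. -/
def scaleProd (s t : ℝ) : ℝ × ℝ →+ ℝ × ℝ where
  toFun z := (s * z.1, t * z.2)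
  map_zero' := by simp
  map_add' x y := by ext <;> simp [mul_add]

theorem scaleProd_apply (s t x y : ℝ) : scaleProd s t (x, y) = (s * x, t * y) := rfl

namespace StripFreePair

variable {L : AddSubgroup (ℝ × ℝ)} {A B : Set (ℝ × ℝ)}

/-- `A` is reflected in y = 0 but `B` in y = 1/2, so that both unit segments are preserved. The
horizontal version uses x = 1/2 for `A` and x = 0 for `B`. -/
theorem reflect_vertical (h : StripFreePair L A B) :
    StripFreePair (L.comap (scaleProd 1 (-1))) {z : ℝ × ℝ | (0 + 1 * z.1, 0 + (-1) * z.2) ∈ A}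
      {z : ℝ × ℝ | (0 + 1 * z.1, 1 + (-1) * z.2) ∈ B} := by
  obtain ⟨hA, hB, hL₁, hL₂, ⟨g₁, g₂, hg, hg₁, hg₁', hg₂, hg₂'⟩, hA₀, hA₁, hB₀, hB₁, hAL, hBL⟩ := h
  refine ⟨hA.preimage_prod_affine .., hB.preimage_prod_affine .., ?_, ?_,
    ⟨g₁, 1 - g₂, ?_, hg₁, hg₁', by linarith, by linarith⟩, ?_, ?_, ?_, ?_, ?_, ?_⟩
  · simpa [scaleProd_apply] using hL₁
  · simpa [scaleProd_apply] using L.neg_mem hL₂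
  · simpa [scaleProd_apply] using L.sub_mem hg hL₂
  · simpa using hA₀
  · simpa using hA₁
  · simpa using hB₁
  · simpa using hB₀
  · intro x y hxy hx
    exact hAL x (-y) (by simpa [scaleProd_apply] using hxy) (by simpa using hx)
  · intro x y hxy hx hy
    by_contra! hy'
    have h1 : (x, 1 - y) ∈ L := by
      have := L.add_mem hL₂ (by simpa [scaleProd_apply] using hxy)
      simpa [sub_eq_add_neg] using this
    have := hBL x (1 - y) h1 (by simpa [sub_eq_add_neg] using hx) (by linarith)
    linarith

theorem reflect_horizontal (h : StripFreePair L A B) :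
    StripFreePair (L.comap (scaleProd (-1) 1)) {z : ℝ × ℝ | (1 + (-1) * z.1, 0 + 1 * z.2) ∈ A}
      {z : ℝ × ℝ | (0 + (-1) * z.1, 0 + 1 * z.2) ∈ B} := by
  obtain ⟨hA, hB, hL₁, hL₂, ⟨g₁, g₂, hg, hg₁, hg₁', hg₂, hg₂'⟩, hA₀, hA₁, hB₀, hB₁, hAL, hBL⟩ := h
  refine ⟨hA.preimage_prod_affine .., hB.preimage_prod_affine .., ?_, ?_,
    ⟨1 - g₁, g₂, ?_, by linarith, by linarith, hg₂, hg₂'⟩, ?_, ?_, ?_, ?_, ?_, ?_⟩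
  · simpa [scaleProd_apply] using L.neg_mem hL₁
  · simpa [scaleProd_apply] using hL₂
  · simpa [scaleProd_apply] using L.sub_mem hg hL₁
  · simpa using hA₁
  · simpa using hA₀
  · simpa using hB₀
  · simpa using hB₁
  · intro x y hxy hx hx0
    by_contra! hx'
    have h1 : (1 - x, y) ∈ L := by
      have := L.add_mem hL₁ (by simpa [scaleProd_apply] using hxy)
      simpa [sub_eq_add_neg] using this
    have := hAL (1 - x) y h1 (by simpa [sub_eq_add_neg] using hx) (by linarith)
    linarith
  · intro x y hxy hx
    exact hBL (-x) y (by simpa [scaleProd_apply] using hxy) (by simpa using hx)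

/-- A negative `a` is made positive by `reflect_vertical`, which swaps the ends of both segments;
for `a = 0` the segment of `A` is itself vertical, of length `b ≥ 1`. -/
theorem exists_vertical_unit_of_edges (h : StripFreePair L A B) {a b q₁ q₂ p₁ p₂ : ℝ}
    (he : ParallelEdges L A B a b q₁ q₂ p₁ p₂) :
    ∃ x y, 1 ≤ x ∧ (x, y) ∈ A ∧ (x, y + 1) ∈ A := by
  rcases lt_trichotomy a 0 with ha | rfl | ha
  · obtain ⟨hab, hq₂, hqb, hQ, hR, hBmax, hpL, hP, hT, hAmax⟩ := he
    have := h.reflect_vertical.exists_vertical_unit_of_pos (a := -a) (b := b) (q₁ := q₁ + a)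
      (q₂ := 1 - (q₂ + b)) (p₁ := p₁ + a) (p₂ := - (p₂ + b)) ⟨?_, ?_, ?_, ?_, ?_, ?_, ?_, ?_, ?_, ?_⟩
      (by linarith)
    · obtain ⟨h1, h2⟩ := this
      refine ⟨p₁ + a, p₂ + b - 1, h1, ?_, ?_⟩
      · have h2 : (0 + 1 * (p₁ + a), 0 + (-1) * (-(p₂ + b) + 1)) ∈ A := h2
        convert h2 using 2 <;> ring
      · convert hT using 2
        ring
    · simpa [scaleProd_apply] using L.neg_mem hab
    · linarith
    · linarith
    · simpa using hR
    · change (0 + 1 * (q₁ + a + -a), 1 + (-1) * (1 - (q₂ + b) + b)) ∈ B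
      convert hQ using 2 <;> ring
    · intro x y hxy
      have := hBmax _ _ hxy
      linarith
    · have := L.add_mem hpL hab
      simpa [scaleProd_apply, add_comm] using this
    · simpa using hT
    · change (0 + 1 * (p₁ + a + -a), 0 + (-1) * (-(p₂ + b) + b)) ∈ A
      convert hP using 2 <;> ring
    · intro x y hxy
      have := hAmax _ _ hxy
      linarith
  · have hb : 1 ≤ b := by linarith [he.le_zero, he.one_le]
    refine ⟨p₁, p₂, ?_, he.left_start, ?_⟩
    · have := he.left_max 1 0 h.left_one
      nlinarith
    · have hT := he.left_end
      rw [add_zero] at hT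
      exact h.convex_left.prodMk_mem_of_vertical he.left_start hT (by linarith) (by linarith)
  · exact ⟨p₁, p₂, (h.exists_vertical_unit_of_pos he ha).1, he.left_start,
      (h.exists_vertical_unit_of_pos he ha).2⟩

end StripFreePair

/-! ### Parallel edges contradict strip-freeness. -/

/-- Every pair of lattice points in a proper face of `B` is parallel to a lattice segment in the
face of `A` with the same normal. -/
def FaceRefines (L : AddSubgroup (ℝ × ℝ)) (A B : Set (ℝ × ℝ)) : Prop :=
  ∀ n₁ n₂ : ℝ, (n₁, n₂) ≠ 0 → ∀ Q R : ℝ × ℝ, Q ∈ L → R ∈ L → Q ∈ B → R ∈ B → Q ≠ R →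
    (∀ z ∈ B, n₁ * z.1 + n₂ * z.2 ≤ n₁ * Q.1 + n₂ * Q.2) →
    (∀ z ∈ B, n₁ * z.1 + n₂ * z.2 ≤ n₁ * R.1 + n₂ * R.2) →
    ∃ w ∈ L, (∃ m : ℕ, R - Q = m • w) ∧ ∃ p ∈ L, p ∈ A ∧ p + w ∈ A ∧
      ∀ z ∈ A, n₁ * z.1 + n₂ * z.2 ≤ n₁ * p.1 + n₂ * p.2

theorem FaceRefines.reflect_horizontal {L : AddSubgroup (ℝ × ℝ)} {A B : Set (ℝ × ℝ)}
    (hL : ((1 : ℝ), (0 : ℝ)) ∈ L) (h : FaceRefines L A B) :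
    FaceRefines (L.comap (scaleProd (-1) 1)) {z : ℝ × ℝ | (1 + (-1) * z.1, 0 + 1 * z.2) ∈ A}
      {z : ℝ × ℝ | (0 + (-1) * z.1, 0 + 1 * z.2) ∈ B} := by
  rintro n₁ n₂ hn ⟨Q₁, Q₂⟩ ⟨R₁, R₂⟩ hQL hRL hQ hR hQR hQm hRm
  simp only [AddSubgroup.mem_comap, scaleProd_apply, Set.mem_ofPred_eq] at hQL hRL hQ hR hQm hRm
  obtain ⟨⟨w₁, w₂⟩, hw, ⟨m, hm⟩, ⟨p₁, p₂⟩, hp, hpA, hpwA, hpm⟩ := h (-n₁) n₂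
    (by simpa using hn) (-Q₁, Q₂) (-R₁, R₂) (by simpa using hQL) (by simpa using hRL)
    (by simpa using hQ) (by simpa using hR) (by simpa using hQR)
    (by
      rintro ⟨x, y⟩ hz
      have := hQm (-x, y) (by simpa using hz)
      simpa using this)
    (by
      rintro ⟨x, y⟩ hz
      have := hRm (-x, y) (by simpa using hz)
      simpa using this)
  simp only [Prod.mk_sub_mk, Prod.smul_mk, Prod.mk.injEq, Prod.mk_add_mk, nsmul_eq_mul] at *
  refine ⟨(-w₁, w₂), by simpa [scaleProd_apply] using hw, ⟨m, ?_⟩, (1 - p₁, p₂), ?_, ?_, ?_, ?_⟩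
  · ext
    · simp; linarith
    · simp; linarith
  · have := L.sub_mem hp hL
    simpa [scaleProd_apply] using this
  · simpa using hpA
  · have : 1 - (1 - p₁ - w₁) = p₁ + w₁ := by ring
    simpa [← sub_eq_add_neg, this] using hpwA
  · rintro ⟨x, y⟩ hz
    have := hpm (1 - x, y) (by simpa [← sub_eq_add_neg] using hz)
    simp at this ⊢
    linarith

theorem linear_le_of_mem_convexHull {S : Set (ℝ × ℝ)} {n₁ n₂ c : ℝ}
    (h : ∀ z ∈ S, n₁ * z.1 + n₂ * z.2 ≤ c) : ∀ z ∈ convexHull ℝ S, n₁ * z.1 + n₂ * z.2 ≤ c := by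
  have : Convex ℝ {z : ℝ × ℝ | n₁ * z.1 + n₂ * z.2 ≤ c} := by
    refine convex_halfSpace_le (f := fun z : ℝ × ℝ => n₁ * z.1 + n₂ * z.2) ⟨?_, ?_⟩ c
    · intro x y; simp; ring
    · intro x y; simp; ring
  exact fun z hz => convexHull_min (fun z hz => h z hz) this hz

namespace StripFreePair

variable {L : AddSubgroup (ℝ × ℝ)} {A B : Set (ℝ × ℝ)}

/-- The rightmost edge of `B` over the unit strip. -/
theorem exists_crossing_edge (h : StripFreePair L A B) (hfin : (B ∩ L).Finite)
    (hhull : B ⊆ convexHull ℝ (B ∩ L)) :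
    ∃ Q R : ℝ × ℝ, Q ∈ L ∧ R ∈ L ∧ Q ∈ B ∧ R ∈ B ∧ Q.2 ≤ 0 ∧ 1 ≤ R.2 ∧
      ∀ z ∈ B, (R.2 - Q.2) * z.1 + -(R.1 - Q.1) * z.2 ≤
        (R.2 - Q.2) * Q.1 + -(R.1 - Q.1) * Q.2 := by
  classical
  -- The abscissa at height 1/2 of the line joining a lattice point below the strip to one above it.
  -- A lattice point of `B` beyond the line of a maximal pair could replace one of the two and
  -- increase `X`, since none lies inside the strip.
  set X : (ℝ × ℝ) × (ℝ × ℝ) → ℝ :=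
    fun w => w.1.1 + (1 / 2 - w.1.2) * ((w.2.1 - w.1.1) / (w.2.2 - w.1.2)) with hX
  set S := hfin.toFinset with hS
  have hmem : ∀ z, z ∈ S ↔ z ∈ B ∧ z ∈ L := fun z => by simp [hS]
  have hne : ((S.filter (fun z => z.2 ≤ 0)) ×ˢ (S.filter (fun z => 1 ≤ z.2))).Nonempty := by
    refine ⟨((0, 0), (0, 1)), ?_⟩
    simp only [Finset.mem_product, Finset.mem_filter, hmem]
    exact ⟨⟨⟨h.right_zero, L.zero_mem⟩, le_rfl⟩, ⟨h.right_one, h.zero_one_mem⟩, le_rfl⟩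
  obtain ⟨⟨Q, R⟩, hQR, hmax⟩ := Finset.exists_max_image _ X hne
  simp only [Finset.mem_product, Finset.mem_filter, hmem] at hQR hmax
  obtain ⟨⟨⟨hQB, hQL⟩, hQ⟩, ⟨hRB, hRL⟩, hR⟩ := hQR
  refine ⟨Q, R, hQL, hRL, hQB, hRB, hQ, hR, ?_⟩
  suffices hs : ∀ z ∈ B ∩ L, (R.2 - Q.2) * z.1 + -(R.1 - Q.1) * z.2 ≤
      (R.2 - Q.2) * Q.1 + -(R.1 - Q.1) * Q.2 from
    fun z hz => linear_le_of_mem_convexHull hs z (hhull hz)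
  rintro ⟨x, y⟩ ⟨hzB, hzL⟩
  have hd : 0 < R.2 - Q.2 := by linarith
  rcases le_or_gt y 0 with hy | hy
  · have := hmax ((x, y), R) ⟨⟨⟨hzB, hzL⟩, hy⟩, ⟨hRB, hRL⟩, hR⟩
    have hd' : 0 < R.2 - y := by linarith
    have e1 : X ((x, y), R) = R.1 - (R.2 - 1 / 2) * ((R.1 - x) / (R.2 - y)) := by
      simp only [hX]
      field_simp
      ring
    have e2 : X (Q, R) = R.1 - (R.2 - 1 / 2) * ((R.1 - Q.1) / (R.2 - Q.2)) := by
      simp only [hX]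
      field_simp
      ring
    rw [e1, e2] at this
    have h3 : (R.1 - Q.1) / (R.2 - Q.2) ≤ (R.1 - x) / (R.2 - y) := by
      by_contra! h4
      nlinarith
    rw [div_le_div_iff₀ hd hd'] at h3
    dsimp only
    linarith
  · have hy1 := h.right_free x y hzL hzB hy
    have := hmax (Q, (x, y)) ⟨⟨⟨hQB, hQL⟩, hQ⟩, ⟨hzB, hzL⟩, hy1⟩
    simp only [hX] at this
    have hd' : 0 < y - Q.2 := by linarith
    have h3 : (x - Q.1) / (y - Q.2) ≤ (R.1 - Q.1) / (R.2 - Q.2) := by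
      by_contra! h4
      nlinarith
    rw [div_le_div_iff₀ hd' hd] at h3
    dsimp only
    linarith

/-- The points `Q + i • w` on the crossing edge avoid the open strip. The first one at height at
least 1 and its predecessor therefore form a single step across the strip. -/
theorem exists_parallelEdges (h : StripFreePair L A B) (hfin : (B ∩ L).Finite)
    (hhull : B ⊆ convexHull ℝ (B ∩ L)) (href : FaceRefines L A B) :
    ∃ a b q₁ q₂ p₁ p₂, ParallelEdges L A B a b q₁ q₂ p₁ p₂ := by
  obtain ⟨Q, R, hQL, hRL, hQB, hRB, hQ, hR, hmax⟩ := h.exists_crossing_edge hfin hhull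
  have hd : 0 < R.2 - Q.2 := by linarith
  obtain ⟨⟨a, b⟩, hw, ⟨m, hm⟩, ⟨p₁, p₂⟩, hp, hpA, hpwA, hpm⟩ :=
    href (R.2 - Q.2) (-(R.1 - Q.1)) (fun h0 => hd.ne' (congrArg Prod.fst h0)) Q R hQL hRL hQB hRB
      (fun h0 => by rw [h0] at hd; simp at hd) hmax
      (fun z hz => (hmax z hz).trans (by linarith))
  obtain ⟨Q₁, Q₂⟩ := Q
  obtain ⟨R₁, R₂⟩ := R
  simp only [Prod.mk_sub_mk, Prod.smul_mk, nsmul_eq_mul, Prod.mk.injEq, Prod.mk_add_mk] at *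
  obtain ⟨hm₁, hm₂⟩ := hm
  have hm0 : (0 : ℝ) < m := by
    rcases Nat.eq_zero_or_pos m with rfl | h0
    · simp at hm₂; linarith
    · exact_mod_cast h0
  rw [hm₁, hm₂] at hmax hpm
  have hex : ∃ i : ℕ, 1 ≤ Q₂ + i * b := ⟨m, by rw [← hm₂]; linarith⟩
  classical
  obtain ⟨j, hj⟩ : ∃ j, Nat.find hex = j + 1 := by
    refine Nat.exists_eq_succ_of_ne_zero fun h0 => ?_
    have := Nat.find_spec hex
    rw [h0] at this
    simp at this
    linarith
  have hj1 := Nat.find_spec hex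
  have hjm : j + 1 ≤ m := by
    rw [← hj]
    exact Nat.find_min' hex (by rw [← hm₂]; linarith)
  have hj0 := Nat.find_min hex (m := j) (by omega)
  rw [hj] at hj1
  push_cast at hj1
  have hmemB : ∀ i : ℕ, i ≤ m → (Q₁ + i * a, Q₂ + i * b) ∈ B := by
    intro i hi
    have := h.convex_right.prodMk_mem_of_mem_segment hQB hRB (s := i / m) (by positivity)
      ((div_le_one hm0).2 (by exact_mod_cast hi))
    rw [hm₁, hm₂] at this
    convert this using 2 <;> field_simp
  have hmemL : ∀ i : ℕ, (Q₁ + i * a, Q₂ + i * b) ∈ L := by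
    intro i
    have := L.add_mem hQL (L.nsmul_mem hw i)
    simpa using this
  refine ⟨a, b, Q₁ + j * a, Q₂ + j * b, p₁, p₂, hw, ?_, by linarith, hmemB j (by omega), ?_, ?_, hp,
    hpA, hpwA, ?_⟩
  · by_contra! h0
    exact hj0 (h.right_free _ _ (hmemL j) (hmemB j (by omega)) h0)
  · have := hmemB (j + 1) hjm
    push_cast at this
    convert this using 2 <;> ring
  · intro x y hxy
    have := hmax (x, y) hxy
    simp only at this
    by_contra! h0
    nlinarith
  · intro x y hxy
    have := hpm (x, y) hxy
    simp only at this
    by_contra! h0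
    nlinarith

/-- Unit vertical segments of `A` on both sides of the strip give, by convexity, one above the
abscissa `g₁` of a lattice point of the unit square. The lattice points on that vertical line
include a column of spacing 1, which meets the segment. -/
theorem not_faceRefines (h : StripFreePair L A B) (hfin : (B ∩ L).Finite)
    (hhull : B ⊆ convexHull ℝ (B ∩ L)) : ¬ FaceRefines L A B := by
  intro href
  obtain ⟨a, b, q₁, q₂, p₁, p₂, he⟩ := h.exists_parallelEdges hfin hhull href
  obtain ⟨x₁, y₁, hx₁, h₁, h₁'⟩ := h.exists_vertical_unit_of_edges he
  have himg : {z : ℝ × ℝ | (0 + (-1) * z.1, 0 + 1 * z.2) ∈ B} ∩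
      (L.comap (scaleProd (-1) 1) : Set (ℝ × ℝ)) = scaleProd (-1) 1 '' (B ∩ L) := by
    ext ⟨x, y⟩
    constructor
    · rintro ⟨hx, hx'⟩
      refine ⟨(-x, y), ⟨by simpa using hx, by simpa [scaleProd_apply] using hx'⟩, ?_⟩
      simp [scaleProd_apply]
    · rintro ⟨⟨x', y'⟩, ⟨hx, hx'⟩, h0⟩
      simp only [scaleProd_apply, Prod.mk.injEq] at h0
      obtain ⟨rfl, rfl⟩ := h0
      exact ⟨by simpa using hx, by simpa [scaleProd_apply] using hx'⟩
  have hhull' : {z : ℝ × ℝ | (0 + (-1) * z.1, 0 + 1 * z.2) ∈ B} ⊆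
      convexHull ℝ ({z : ℝ × ℝ | (0 + (-1) * z.1, 0 + 1 * z.2) ∈ B} ∩
        (L.comap (scaleProd (-1) 1) : Set (ℝ × ℝ))) := by
    rw [himg]
    let f : ℝ × ℝ →ₗ[ℝ] ℝ × ℝ := (-LinearMap.fst ℝ ℝ ℝ).prod (LinearMap.snd ℝ ℝ ℝ)
    have hf : (scaleProd (-1) 1 : ℝ × ℝ → ℝ × ℝ) = f := by
      ext z <;> simp [f, scaleProd]
    rw [hf, ← f.image_convexHull]
    rintro ⟨x, y⟩ hx
    exact ⟨(-x, y), hhull (by simpa using hx), by simp [f]⟩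
  obtain ⟨a', b', q₁', q₂', p₁', p₂', he'⟩ := h.reflect_horizontal.exists_parallelEdges
    (by rw [himg]; exact hfin.image _) hhull' (href.reflect_horizontal h.one_zero_mem)
  obtain ⟨x₂, y₂, hx₂, h₂, h₂'⟩ := h.reflect_horizontal.exists_vertical_unit_of_edges he'
  have h₂ : (1 + (-1) * x₂, 0 + 1 * y₂) ∈ A := h₂
  have h₂' : (1 + (-1) * x₂, 0 + 1 * (y₂ + 1)) ∈ A := h₂'
  obtain ⟨g₁, g₂, hg, hg₁, hg₁', -, -⟩ := h.exists_mem
  have k₁ := h.convex_left.prodMk_mem_of_abscissa h₂ h₁ (x := g₁) (by linarith) (by linarith)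
    (by linarith)
  have k₂ := h.convex_left.prodMk_mem_of_abscissa h₂' h₁' (x := g₁) (by linarith) (by linarith)
    (by linarith)
  rw [show y₁ + 1 - (0 + 1 * (y₂ + 1)) = y₁ - (0 + 1 * y₂) by ring] at k₂
  set c := (g₁ - (1 + -1 * x₂)) * ((y₁ - (0 + 1 * y₂)) / (x₁ - (1 + -1 * x₂)))
  have hgL : (g₁, g₂ + ⌈0 + 1 * y₂ + c - g₂⌉) ∈ L := by
    have := L.add_mem hg (L.zsmul_mem h.zero_one_mem ⌈0 + 1 * y₂ + c - g₂⌉)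
    simpa using this
  have c1 := Int.le_ceil (0 + 1 * y₂ + c - g₂)
  have c2 := Int.ceil_lt_add_one (0 + 1 * y₂ + c - g₂)
  have := h.left_free _ _ hgL
    (h.convex_left.prodMk_mem_of_vertical k₁ k₂ (by linarith) (by linarith)) hg₁
  linarith

end StripFreePair

/-! ### Lattice tetrahedra, their volumes, and pivoting. -/

theorem latticePoint_add {d : ℕ} (v w : Fin d → ℤ) :
    latticePoint (v + w) = latticePoint v + latticePoint w := by
  ext i; simp [latticePoint]

theorem latticePoint_sub {d : ℕ} (v w : Fin d → ℤ) :
    latticePoint (v - w) = latticePoint v - latticePoint w := by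
  ext i; simp [latticePoint]

theorem latticePoint_zsmul {d : ℕ} (m : ℤ) (v : Fin d → ℤ) :
    latticePoint (m • v) = (m : ℝ) • latticePoint v := by
  ext i; simp [latticePoint]

theorem latticePoint_nsmul {d : ℕ} (m : ℕ) (v : Fin d → ℤ) :
    latticePoint (m • v) = (m : ℝ) • latticePoint v := by
  ext i; simp [latticePoint]

theorem latticePoint_neg {d : ℕ} (v : Fin d → ℤ) : latticePoint (-v) = -latticePoint v := by
  ext i; simp [latticePoint]

theorem latticePoint_zero {d : ℕ} : latticePoint (0 : Fin d → ℤ) = 0 := by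
  ext i; simp [latticePoint]

theorem latticePoint_injective {d : ℕ} : Function.Injective (latticePoint (d := d)) := by
  intro v w h
  ext i
  have := congrFun h i
  simpa [latticePoint] using this

/-- The normalized signed volume of a lattice tetrahedron. -/
def tetraDet (c : Fin 4 → Fin 3 → ℤ) : ℤ := (Matrix.of fun i j : Fin 3 => c i.succ j - c 0 j).det

/-- The matrix of homogeneous coordinates of the vertices of a lattice tetrahedron. -/
def homMatrix (c : Fin 4 → Fin 3 → ℤ) : Matrix (Fin 4) (Fin 4) ℝ :=
  Matrix.of fun i => Fin.cons 1 (latticePoint (c i))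

theorem det_homMatrix (c : Fin 4 → Fin 3 → ℤ) : (homMatrix c).det = tetraDet c := by
  have h : (tetraDet c : ℝ) = ((Matrix.of fun i j : Fin 3 => c i.succ j - c 0 j).map
      (Int.castRingHom ℝ)).det := by
    rw [← RingHom.mapMatrix_apply, ← RingHom.map_det]
    rfl
  rw [h, Matrix.det_fin_three, Matrix.det_succ_row_zero]
  simp only [Fin.sum_univ_succ, Matrix.det_fin_three, homMatrix]
  simp [latticePoint, Fin.succAbove, Fin.cons, Fin.ext_iff]
  simp [latticePoint, Fin.cases, Fin.induction, Fin.induction.go]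
  ring

theorem tetraDet_comp_perm (c : Fin 4 → Fin 3 → ℤ) (σ : Equiv.Perm (Fin 4)) :
    |tetraDet (c ∘ σ)| = |tetraDet c| := by
  have h : (tetraDet (c ∘ σ) : ℝ) = ((Equiv.Perm.sign σ : ℤ) : ℝ) * tetraDet c := by
    rw [← det_homMatrix, ← det_homMatrix, ← Matrix.det_permute]
    rfl
  have h' : tetraDet (c ∘ σ) = (Equiv.Perm.sign σ : ℤ) * tetraDet c := by exact_mod_cast h
  rw [h', abs_mul]
  rcases Int.units_eq_one_or (Equiv.Perm.sign σ) with h | h <;> simp [h]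

theorem homMatrix_update (c : Fin 4 → Fin 3 → ℤ) (i : Fin 4) (r : Fin 3 → ℤ) (μ : Fin 4 → ℝ)
    (hr : latticePoint r = ∑ j, μ j • latticePoint (c j)) (hμ : ∑ j, μ j = 1) :
    homMatrix (Function.update c i r) =
      (homMatrix c).updateRow i (∑ j, μ j • homMatrix c j) := by
  ext j k
  by_cases hj : j = i
  · subst hj
    rw [Matrix.updateRow_self]
    refine Fin.cases ?_ (fun k => ?_) k
    · simp [homMatrix, hμ]
    · have := congrFun hr k
      simpa [homMatrix] using this
  · rw [Matrix.updateRow_ne hj]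
    simp [homMatrix, hj]

/-- In homogeneous coordinates row `i` becomes the combination of all rows with coefficients `μ`;
only the `i`-th term survives in the determinant. -/
theorem tetraDet_update (c : Fin 4 → Fin 3 → ℤ) (i : Fin 4) (r : Fin 3 → ℤ) (μ : Fin 4 → ℝ)
    (hr : latticePoint r = ∑ j, μ j • latticePoint (c j)) (hμ : ∑ j, μ j = 1) :
    (tetraDet (Function.update c i r) : ℝ) = μ i * tetraDet c := by
  rw [← det_homMatrix, homMatrix_update c i r μ hr hμ, Matrix.det_updateRow_sum, det_homMatrix,
    smul_eq_mul]

/-- The convex hull of the vertices of a lattice tetrahedron. -/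
def tetra (c : Fin 4 → Fin 3 → ℤ) : Set (Fin 3 → ℝ) :=
  convexHull ℝ (Set.range fun i => latticePoint (c i))

theorem mem_tetra_iff {c : Fin 4 → Fin 3 → ℤ} {y : Fin 3 → ℝ} :
    y ∈ tetra c ↔ ∃ w : Fin 4 → ℝ, (∀ i, 0 ≤ w i) ∧ ∑ i, w i = 1 ∧
      ∑ i, w i • latticePoint (c i) = y := by
  rw [tetra, convexHull_range_eq_exists_affineCombination]
  constructor
  · rintro ⟨s, w, hw, hw1, rfl⟩
    refine ⟨fun i => if i ∈ s then w i else 0, fun i => ?_, ?_, ?_⟩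
    · dsimp only
      split_ifs with hi
      · exact hw i hi
      · exact le_rfl
    · simpa using hw1
    · rw [Finset.affineCombination_eq_linear_combination _ _ _ hw1]
      simp
  · rintro ⟨w, hw, hw1, rfl⟩
    refine ⟨Finset.univ, w, fun i _ => hw i, hw1, ?_⟩
    rw [Finset.affineCombination_eq_linear_combination _ _ _ hw1]

/-- Replacing a vertex of a tetrahedron by another point while keeping a given point inside. -/
theorem exists_pivot {c : Fin 4 → Fin 3 → ℤ} {r : Fin 3 → ℤ} {μ : Fin 4 → ℝ}
    (hr : latticePoint r = ∑ j, μ j • latticePoint (c j)) (hμ : ∑ j, μ j = 1) {y : Fin 3 → ℝ}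
    (hy : y ∈ tetra c) : ∃ i, 0 < μ i ∧ y ∈ tetra (Function.update c i r) := by
  obtain ⟨w, hw, hw1, hwy⟩ := mem_tetra_iff.1 hy
  have hne : (Finset.univ.filter fun i => 0 < μ i).Nonempty := by
    by_contra! h
    rw [Finset.filter_eq_empty_iff] at h
    have : ∑ j, μ j ≤ 0 := Finset.sum_nonpos fun j _ => not_lt.1 (h (Finset.mem_univ j))
    linarith
  -- The ratio test of the simplex method: the least ratio is the largest weight that can be shifted
  -- to `r` while all other weights stay nonnegative.
  obtain ⟨i, hi, hmin⟩ := Finset.exists_min_image _ (fun i => w i / μ i) hne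
  simp only [Finset.mem_filter, Finset.mem_univ, true_and] at hi hmin
  refine ⟨i, hi, mem_tetra_iff.2 ?_⟩
  set s := w i / μ i with hs
  have hs0 : 0 ≤ s := div_nonneg (hw i) hi.le
  have hsi : s * μ i = w i := div_mul_cancel₀ _ hi.ne'
  refine ⟨fun j => w j - s * μ j + if j = i then s else 0, fun j => ?_, ?_, ?_⟩
  · have : 0 ≤ w j - s * μ j := by
      rcases le_or_gt (μ j) 0 with hj | hj
      · nlinarith [hw j]
      · have := hmin j hj
        rw [le_div_iff₀ hj] at this
        linarith
    dsimp only
    split_ifs <;> linarith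
  · simp only [Finset.sum_add_distrib, Finset.sum_sub_distrib, ← Finset.mul_sum, hw1, hμ]
    simp
  · have h1 : ∀ j, (w j - s * μ j + if j = i then s else 0) •
        latticePoint (Function.update c i r j) =
        (w j - s * μ j) • latticePoint (c j) + if j = i then s • latticePoint r else 0 := by
      intro j
      by_cases hj : j = i
      · subst hj
        simp [hsi]
      · simp [hj]
    simp only [h1, Finset.sum_add_distrib, sub_smul, Finset.sum_sub_distrib, mul_smul,
      ← Finset.smul_sum, hwy, ← hr]
    simp

/-- If every non-unimodular tetrahedron with vertices in `S` can be pivoted at a point of `S` with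
all barycentric coordinates less than one, then the unimodular ones cover all the others. -/
theorem exists_unimodular_tetra {S : Set (Fin 3 → ℤ)}
    (hS : ∀ c : Fin 4 → Fin 3 → ℤ, (∀ i, c i ∈ S) → 2 ≤ |tetraDet c| →
      ∃ r ∈ S, ∃ μ : Fin 4 → ℝ, latticePoint r = ∑ j, μ j • latticePoint (c j) ∧ ∑ j, μ j = 1 ∧
        ∀ j, μ j < 1)
    {y : Fin 3 → ℝ} {c : Fin 4 → Fin 3 → ℤ} (hc : ∀ i, c i ∈ S) (hc0 : tetraDet c ≠ 0)
    (hy : y ∈ tetra c) :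
    ∃ c' : Fin 4 → Fin 3 → ℤ, (∀ i, c' i ∈ S) ∧ IsUnit (tetraDet c') ∧ y ∈ tetra c' := by
  induction hn : (tetraDet c).natAbs using Nat.strong_induction_on generalizing c with
  | _ n ih =>
    by_cases h2 : 2 ≤ |tetraDet c|
    · obtain ⟨r, hrS, μ, hr, hμ, hlt⟩ := hS c hc h2
      obtain ⟨i, hi, hyi⟩ := exists_pivot hr hμ hy
      have hdet := tetraDet_update c i r μ hr hμ
      have hc0' : (tetraDet c : ℝ) ≠ 0 := by exact_mod_cast hc0
      refine ih _ ?_ (c := Function.update c i r) ?_ ?_ hyi rfl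
      · rw [← hn]
        have : |(tetraDet (Function.update c i r) : ℝ)| < |(tetraDet c : ℝ)| := by
          rw [hdet, abs_mul, abs_of_pos hi]
          exact mul_lt_of_lt_one_left (abs_pos.2 hc0') (hlt i)
        have : |tetraDet (Function.update c i r)| < |tetraDet c| := by exact_mod_cast this
        zify
        exact this
      · intro j
        by_cases hj : j = i
        · subst hj; simpa using hrS
        · simpa [hj] using hc j
      · have : (tetraDet (Function.update c i r) : ℝ) ≠ 0 := by
          rw [hdet]
          exact mul_ne_zero hi.ne' hc0'
        exact_mod_cast this
    · refine ⟨c, hc, ?_, hy⟩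
      rw [Int.isUnit_iff_abs_eq]
      have := abs_pos.2 hc0
      omega

/-! ### Lattice points in parallelograms and triangles. -/

/-- A lattice point in the half-open parallelogram spanned by two horizontal vectors. -/
theorem exists_mem_parallelogram {u v : Fin 3 → ℤ} (hu : u 2 = 0) (hv : v 2 = 0)
    (hd : 2 ≤ |u 0 * v 1 - u 1 * v 0|) :
    ∃ (w : Fin 3 → ℤ) (α β : ℝ), latticePoint w = α • latticePoint u + β • latticePoint v ∧
      w 2 = 0 ∧ 0 ≤ α ∧ α < 1 ∧ 0 ≤ β ∧ β < 1 ∧ (α ≠ 0 ∨ β ≠ 0) := by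
  set d := u 0 * v 1 - u 1 * v 0 with hdef
  have hd0 : d ≠ 0 := by rintro h; simp [h] at hd
  have hdR : (d : ℝ) ≠ 0 := by exact_mod_cast hd0
  -- These are the numerators of Cramer's rule. Were they divisible by `d` for both horizontal unit
  -- vectors, `d ^ 2` would divide `d`.
  obtain ⟨x, hx2, hx⟩ : ∃ x : Fin 3 → ℤ, x 2 = 0 ∧
      ¬ (d ∣ x 0 * v 1 - x 1 * v 0 ∧ d ∣ u 0 * x 1 - u 1 * x 0) := by
    by_contra! h
    obtain ⟨⟨p, hp⟩, q, hq⟩ := h ![1, 0, 0] rfl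
    obtain ⟨⟨s, hs⟩, t, ht⟩ := h ![0, 1, 0] rfl
    simp at hp hq hs ht
    have h1 : d = d * (d * (t * p - q * s)) := by
      have : u 1 = -(d * q) := by linarith
      have h3 : v 0 = -(d * s) := by linarith
      calc d = u 0 * v 1 - u 1 * v 0 := hdef
        _ = _ := by rw [ht, hp, this, h3]; ring
    have h2 : d * (t * p - q * s) = 1 := by
      have := mul_left_cancel₀ hd0 (h1.symm.trans (mul_one d).symm)
      exact this
    have := Int.isUnit_iff_abs_eq.1 (IsUnit.of_mul_eq_one _ h2)
    omega
  set α : ℝ := (x 0 * v 1 - x 1 * v 0) / d with hα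
  set β : ℝ := (u 0 * x 1 - u 1 * x 0) / d with hβ
  have hdv : (d : ℝ) = u 0 * v 1 - u 1 * v 0 := by rw [hdef]; push_cast; ring
  have hxe : latticePoint x = α • latticePoint u + β • latticePoint v := by
    ext i
    fin_cases i
    · simp [latticePoint, hα, hβ]
      rw [div_mul_eq_mul_div, div_mul_eq_mul_div, ← add_div, eq_div_iff hdR, hdv]; ring
    · simp [latticePoint, hα, hβ]
      rw [div_mul_eq_mul_div, div_mul_eq_mul_div, ← add_div, eq_div_iff hdR, hdv]; ring
    · simp [latticePoint, hx2, hu, hv]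
  refine ⟨x - ⌊α⌋ • u - ⌊β⌋ • v, Int.fract α, Int.fract β, ?_, ?_, Int.fract_nonneg _,
    Int.fract_lt_one _, Int.fract_nonneg _, Int.fract_lt_one _, ?_⟩
  · rw [latticePoint_sub, latticePoint_sub, latticePoint_zsmul, latticePoint_zsmul, hxe,
      ← Int.self_sub_floor, ← Int.self_sub_floor]
    module
  · simp [hx2, hu, hv]
  · by_contra! h
    refine hx ⟨⟨⌊α⌋, ?_⟩, ⌊β⌋, ?_⟩
    · have h1 := Int.self_sub_floor α
      rw [h.1] at h1
      have : (x 0 * v 1 - x 1 * v 0 : ℝ) = d * ⌊α⌋ := by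
        rw [← sub_eq_zero.1 h1, hα]; field_simp
      exact_mod_cast this
    · have h1 := Int.self_sub_floor β
      rw [h.2] at h1
      have : (u 0 * x 1 - u 1 * x 0 : ℝ) = d * ⌊β⌋ := by
        rw [← sub_eq_zero.1 h1, hβ]; field_simp
      exact_mod_cast this

/-- A point of the parallelogram beyond the diagonal enters the triangle under the half-turn `w ↦ u
+ v - w`. -/
theorem exists_mem_triangle {u v : Fin 3 → ℤ} (hu : u 2 = 0) (hv : v 2 = 0)
    (hd : 2 ≤ |u 0 * v 1 - u 1 * v 0|) :
    ∃ (w : Fin 3 → ℤ) (α β : ℝ), latticePoint w = α • latticePoint u + β • latticePoint v ∧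
      w 2 = 0 ∧ 0 ≤ α ∧ α < 1 ∧ 0 ≤ β ∧ β < 1 ∧ 0 < α + β ∧ α + β ≤ 1 := by
  obtain ⟨w, α, β, hw, hw2, hα, hα', hβ, hβ', hne⟩ := exists_mem_parallelogram hu hv hd
  rcases le_or_gt (α + β) 1 with h | h
  · refine ⟨w, α, β, hw, hw2, hα, hα', hβ, hβ', ?_, h⟩
    rcases hne with h | h
    · have := lt_of_le_of_ne hα h.symm
      linarith
    · have := lt_of_le_of_ne hβ h.symm
      linarith
  · refine ⟨u + v - w, 1 - α, 1 - β, ?_, by simp [hu, hv, hw2], by linarith, by linarith,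
      by linarith, by linarith, by linarith, by linarith⟩
    rw [latticePoint_sub, latticePoint_add, hw]
    module

/-! ### Slices of a slab in planar coordinates. -/

/-- The slice of `P` at height `k + 1` is a lattice polygon all of whose edges are parallel to edges
of the slice at height `k`. -/
structure SlabRefines (P : Set (Fin 3 → ℝ)) (k : ℤ) : Prop where
  convex : Convex ℝ P
  finite : {g : Fin 3 → ℤ | latticePoint g ∈ P ∧ g 2 = k + 1}.Finite
  hull : ∀ x ∈ P, x 2 = k + 1 →
    x ∈ convexHull ℝ (latticePoint '' {g : Fin 3 → ℤ | latticePoint g ∈ P ∧ g 2 = k + 1})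
  refines : ∀ f : (Fin 3 → ℝ) →ₗ[ℝ] ℝ, (∃ x, x 2 = 0 ∧ f x ≠ 0) → ∀ Q R : Fin 3 → ℤ,
    Q 2 = k + 1 → R 2 = k + 1 → latticePoint Q ∈ P → latticePoint R ∈ P → Q ≠ R →
    (∀ x ∈ P, x 2 = k + 1 → f x ≤ f (latticePoint Q)) →
    (∀ x ∈ P, x 2 = k + 1 → f x ≤ f (latticePoint R)) →
    ∃ w : Fin 3 → ℤ, w 2 = 0 ∧ (∃ m : ℕ, R - Q = m • w) ∧ ∃ p : Fin 3 → ℤ, p 2 = k ∧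
      latticePoint p ∈ P ∧ latticePoint (p + w) ∈ P ∧
      ∀ x ∈ P, x 2 = k → f x ≤ f (latticePoint p)

/-- The linear map sending `(α, β)` to `α u + β v`. -/
noncomputable def planeMap (u v : Fin 3 → ℤ) : ℝ × ℝ →ₗ[ℝ] (Fin 3 → ℝ) :=
  (LinearMap.toSpanSingleton ℝ (Fin 3 → ℝ) (latticePoint u)).coprod
    (LinearMap.toSpanSingleton ℝ (Fin 3 → ℝ) (latticePoint v))

theorem planeMap_apply (u v : Fin 3 → ℤ) (x y : ℝ) :
    planeMap u v (x, y) = x • latticePoint u + y • latticePoint v := by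
  simp [planeMap]

theorem planeMap_apply_two {u v : Fin 3 → ℤ} (hu : u 2 = 0) (hv : v 2 = 0) (z : ℝ × ℝ) :
    planeMap u v z 2 = 0 := by
  obtain ⟨x, y⟩ := z
  simp [planeMap_apply, latticePoint, hu, hv]

/-- The coordinates with respect to two vectors in the horizontal plane. -/
noncomputable def planeCoord (u v : Fin 3 → ℤ) : (Fin 3 → ℝ) →ₗ[ℝ] ℝ × ℝ where
  toFun x := ((x 0 * v 1 - x 1 * v 0) / (u 0 * v 1 - u 1 * v 0),
    (u 0 * x 1 - u 1 * x 0) / (u 0 * v 1 - u 1 * v 0))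
  map_add' x y := by
    ext <;> simp <;> ring
  map_smul' c x := by
    ext <;> simp <;> ring

theorem planeCoord_planeMap {u v : Fin 3 → ℤ} (hd : u 0 * v 1 - u 1 * v 0 ≠ 0) (z : ℝ × ℝ) : planeCoord u v (planeMap u v z) = z := by
  have hdR : (u 0 * v 1 - u 1 * v 0 : ℝ) ≠ 0 := by exact_mod_cast hd
  obtain ⟨x, y⟩ := z
  rw [planeMap_apply]
  simp only [planeCoord, latticePoint, LinearMap.coe_mk, AddHom.coe_mk, Pi.add_apply,
    Pi.smul_apply, smul_eq_mul, Prod.mk.injEq]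
  constructor
  · rw [div_eq_iff hdR]; ring
  · rw [div_eq_iff hdR]; ring

theorem planeMap_planeCoord {u v : Fin 3 → ℤ} (hd : u 0 * v 1 - u 1 * v 0 ≠ 0) (hu : u 2 = 0)
    (hv : v 2 = 0) {x : Fin 3 → ℝ} (hx : x 2 = 0) :
    planeMap u v (planeCoord u v x) = x := by
  have hdR : (u 0 * v 1 - u 1 * v 0 : ℝ) ≠ 0 := by exact_mod_cast hd
  simp only [planeCoord, planeMap_apply, LinearMap.coe_mk, AddHom.coe_mk]
  ext i
  fin_cases i
  · simp [latticePoint]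
    rw [div_mul_eq_mul_div, div_mul_eq_mul_div, ← add_div, div_eq_iff hdR]; ring
  · simp [latticePoint]
    rw [div_mul_eq_mul_div, div_mul_eq_mul_div, ← add_div, div_eq_iff hdR]; ring
  · simp [latticePoint, hu, hv, hx]

/-- The lattice points in the coordinates `planeCoord u v`. -/
noncomputable def planeLattice (u v : Fin 3 → ℤ) : AddSubgroup (ℝ × ℝ) where
  carrier := {z | ∃ g : Fin 3 → ℤ, latticePoint g = planeMap u v z}
  add_mem' := by
    rintro x y ⟨g, hg⟩ ⟨g', hg'⟩
    exact ⟨g + g', by rw [latticePoint_add, hg, hg', map_add]⟩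
  zero_mem' := ⟨0, by rw [latticePoint_zero, map_zero]⟩
  neg_mem' := by
    rintro x ⟨g, hg⟩
    exact ⟨-g, by rw [latticePoint_neg, hg, map_neg]⟩

theorem apply_two_of_latticePoint_eq {u v : Fin 3 → ℤ} (hu : u 2 = 0) (hv : v 2 = 0)
    {g : Fin 3 → ℤ} {z : ℝ × ℝ} (h : latticePoint g = planeMap u v z) : g 2 = 0 := by
  have := congrFun h 2
  rw [planeMap_apply_two hu hv] at this
  simpa [latticePoint] using this

/-- The points of `P` on the horizontal plane through `c`, in the coordinates `planeCoord u v`. -/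
def planeSlice (P : Set (Fin 3 → ℝ)) (c u v : Fin 3 → ℤ) : Set (ℝ × ℝ) :=
  {z | latticePoint c + planeMap u v z ∈ P}

theorem convex_planeSlice {P : Set (Fin 3 → ℝ)} (hP : Convex ℝ P) (c u v : Fin 3 → ℤ) :
    Convex ℝ (planeSlice P c u v) := by
  intro x hx y hy α β hα hβ hαβ
  have h := hP hx hy hα hβ hαβ
  simp only [planeSlice, Set.mem_ofPred_eq] at h ⊢
  convert h using 1
  rw [map_add, map_smul, map_smul]
  have : latticePoint c = α • latticePoint c + β • latticePoint c := by
    rw [← add_smul, hαβ, one_smul]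
  nth_rewrite 1 [this]
  module

namespace SlabRefines

variable {P : Set (Fin 3 → ℝ)} {k : ℤ} {u v c₀ c₂ : Fin 3 → ℤ}

theorem image_planeSlice_inter (hu : u 2 = 0) (hv : v 2 = 0)
    (hd : u 0 * v 1 - u 1 * v 0 ≠ 0) (hc₂ : c₂ 2 = k + 1) :
    (fun z => latticePoint c₂ + planeMap u v z) '' (planeSlice P c₂ u v ∩ planeLattice u v) =
      latticePoint '' {g : Fin 3 → ℤ | latticePoint g ∈ P ∧ g 2 = k + 1} := by
  ext x
  constructor
  · rintro ⟨z, ⟨hz, g, hg⟩, rfl⟩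
    refine ⟨c₂ + g, ⟨?_, ?_⟩, ?_⟩
    · rw [latticePoint_add, hg]
      exact hz
    · simp [hc₂, apply_two_of_latticePoint_eq hu hv hg]
    · rw [latticePoint_add, hg]
  · rintro ⟨g, ⟨hgP, hg⟩, rfl⟩
    have h1 : planeMap u v (planeCoord u v (latticePoint (g - c₂))) = latticePoint (g - c₂) :=
      planeMap_planeCoord hd hu hv (by simp [latticePoint, hg, hc₂])
    have h2 : latticePoint c₂ + planeMap u v (planeCoord u v (latticePoint (g - c₂))) =
        latticePoint g := by
      rw [h1, latticePoint_sub]; abel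
    refine ⟨planeCoord u v (latticePoint (g - c₂)), ⟨?_, ⟨g - c₂, h1.symm⟩⟩, h2⟩
    change _ ∈ P
    rw [h2]
    exact hgP

/-- A planar functional is pulled back along `planeCoord`. On each horizontal plane the pullback
agrees with it up to a constant, so maximizers on slices correspond. -/
theorem faceRefines (h : SlabRefines P k) (hu : u 2 = 0) (hv : v 2 = 0)
    (hd : u 0 * v 1 - u 1 * v 0 ≠ 0) (hc₀ : c₀ 2 = k) (hc₂ : c₂ 2 = k + 1) :
    FaceRefines (planeLattice u v) (planeSlice P c₀ u v) (planeSlice P c₂ u v) := by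
  rintro n₁ n₂ hn Q R ⟨gQ, hgQ⟩ ⟨gR, hgR⟩ hQ hR hQR hQm hRm
  set f : (Fin 3 → ℝ) →ₗ[ℝ] ℝ :=
    (n₁ • LinearMap.fst ℝ ℝ ℝ + n₂ • LinearMap.snd ℝ ℝ ℝ) ∘ₗ planeCoord u v with hf
  have hfm : ∀ z, f (planeMap u v z) = n₁ * z.1 + n₂ * z.2 := fun z => by
    simp [hf, planeCoord_planeMap hd]
  have hlev : ∀ {c : Fin 3 → ℤ} {x : Fin 3 → ℝ}, x 2 = c 2 → x ∈ P →
      planeCoord u v (x - latticePoint c) ∈ planeSlice P c u v ∧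
      f x = f (latticePoint c) + (n₁ * (planeCoord u v (x - latticePoint c)).1 +
        n₂ * (planeCoord u v (x - latticePoint c)).2) := by
    intro c x hx hxP
    have h1 : planeMap u v (planeCoord u v (x - latticePoint c)) = x - latticePoint c :=
      planeMap_planeCoord hd hu hv (by simp [latticePoint, hx])
    constructor
    · change _ ∈ P
      rw [h1]
      simpa using hxP
    · rw [← hfm, h1]
      simp
  have hmax : ∀ {c : Fin 3 → ℤ} {g : Fin 3 → ℤ} {S : ℝ × ℝ}, latticePoint g = planeMap u v S →
      (∀ z ∈ planeSlice P c u v, n₁ * z.1 + n₂ * z.2 ≤ n₁ * S.1 + n₂ * S.2) →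
      ∀ x ∈ P, x 2 = c 2 → f x ≤ f (latticePoint (c + g)) := by
    intro c g S hg hS x hxP hx
    obtain ⟨h1, h2⟩ := hlev hx hxP
    rw [h2, latticePoint_add, hg, map_add, hfm]
    have := hS _ h1
    linarith
  obtain ⟨w, hw2, ⟨m, hm⟩, p, hp2, hpP, hpwP, hpm⟩ := h.refines f
    ⟨planeMap u v (n₁, n₂), planeMap_apply_two hu hv _, by
      rw [hfm]
      intro h0
      apply hn
      have h1 : n₁ = 0 := by nlinarith
      have h2 : n₂ = 0 := by nlinarith
      simp [h1, h2]⟩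
    (c₂ + gQ) (c₂ + gR) (by simp [hc₂, apply_two_of_latticePoint_eq hu hv hgQ])
    (by simp [hc₂, apply_two_of_latticePoint_eq hu hv hgR])
    (by rw [latticePoint_add, hgQ]; exact hQ) (by rw [latticePoint_add, hgR]; exact hR)
    (by
      intro h0
      apply hQR
      rw [← planeCoord_planeMap hd Q, ← planeCoord_planeMap hd R, ← hgQ, ← hgR,
        add_left_cancel h0])
    (fun x hxP hx => hmax hgQ hQm x hxP (by rw [hx, hc₂]; simp))
    (fun x hxP hx => hmax hgR hRm x hxP (by rw [hx, hc₂]; simp))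
  have hwm : planeMap u v (planeCoord u v (latticePoint w)) = latticePoint w :=
    planeMap_planeCoord hd hu hv (by simp [latticePoint, hw2])
  have hpm' : planeMap u v (planeCoord u v (latticePoint (p - c₀))) = latticePoint (p - c₀) :=
    planeMap_planeCoord hd hu hv (by simp [latticePoint, hp2, hc₀])
  refine ⟨planeCoord u v (latticePoint w), ⟨w, hwm.symm⟩, ⟨m, ?_⟩,
    planeCoord u v (latticePoint (p - c₀)), ⟨p - c₀, hpm'.symm⟩, ?_, ?_, ?_⟩
  · have : R - Q = planeCoord u v (latticePoint (c₂ + gR - (c₂ + gQ))) := by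
      rw [add_sub_add_left_eq_sub, latticePoint_sub, hgR, hgQ, map_sub, planeCoord_planeMap hd,
        planeCoord_planeMap hd]
    rw [this, hm, latticePoint_nsmul, map_smul, Nat.cast_smul_eq_nsmul]
  · change _ ∈ P
    rw [hpm', ← latticePoint_add]
    simpa using hpP
  · change _ ∈ P
    rw [map_add, hpm', hwm, ← latticePoint_add, ← latticePoint_add]
    convert hpwP using 2
    abel
  · intro z hz
    have := hpm _ hz (by
      rw [Pi.add_apply, planeMap_apply_two hu hv]
      simp [latticePoint, hc₀])
    rw [map_add, hfm] at this
    have h2 : f (latticePoint p) = f (latticePoint c₀) + f (latticePoint (p - c₀)) := by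
      rw [← map_add, ← latticePoint_add]; simp
    rw [h2, ← hpm', hfm] at this
    linarith

/-- Two non-parallel primitive lattice segments at heights `k` and `k + 1` spanning a parallelogram
of area at least two: one of the two slices has a lattice point in a strip over the segment. -/
theorem exists_strip_mem (h : SlabRefines P k) (hu : u 2 = 0) (hv : v 2 = 0)
    (hd : 2 ≤ |u 0 * v 1 - u 1 * v 0|) (hc₀ : c₀ 2 = k) (hc₂ : c₂ 2 = k + 1)
    (h0 : latticePoint c₀ ∈ P) (h1 : latticePoint (c₀ + u) ∈ P)
    (h2 : latticePoint c₂ ∈ P) (h3 : latticePoint (c₂ + v) ∈ P)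
    (hup : ∀ x : ℝ, 0 < x → x < 1 → (x, (0 : ℝ)) ∉ planeLattice u v)
    (hvp : ∀ y : ℝ, 0 < y → y < 1 → ((0 : ℝ), y) ∉ planeLattice u v) :
    (∃ x y : ℝ, (x, y) ∈ planeLattice u v ∧ (x, y) ∈ planeSlice P c₀ u v ∧ 0 < x ∧ x < 1) ∨
      ∃ x y : ℝ, (x, y) ∈ planeLattice u v ∧ (x, y) ∈ planeSlice P c₂ u v ∧ 0 < y ∧ y < 1 := by
  have hd0 : u 0 * v 1 - u 1 * v 0 ≠ 0 := by
    intro h0; simp [h0] at hd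
  by_contra! hcon
  have hu1 : planeMap u v (1, 0) = latticePoint u := by simp [planeMap_apply]
  have hv1 : planeMap u v (0, 1) = latticePoint v := by simp [planeMap_apply]
  have hpair : StripFreePair (planeLattice u v) (planeSlice P c₀ u v) (planeSlice P c₂ u v) := by
    refine ⟨convex_planeSlice h.convex .., convex_planeSlice h.convex .., ⟨u, hu1.symm⟩,
      ⟨v, hv1.symm⟩, ?_, ?_, ?_, ?_, ?_, hcon.1, hcon.2⟩
    -- The primitivity conditions `hup` and `hvp` keep this lattice point off the axes.
    · obtain ⟨w, α, β, hw, -, hα, hα', hβ, hβ', hne⟩ := exists_mem_parallelogram hu hv hd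
      have hmem : (α, β) ∈ planeLattice u v := ⟨w, by rw [hw, planeMap_apply]⟩
      refine ⟨α, β, hmem, ?_, hα', ?_, hβ'⟩
      · rcases hα.eq_or_lt with h | h
        · subst h
          rcases hβ.eq_or_lt with h | h
          · subst h; simp at hne
          · exact absurd hmem (hvp β h hβ')
        · exact h
      · rcases hβ.eq_or_lt with h | h
        · subst h
          rcases hα.eq_or_lt with h | h
          · subst h; simp at hne
          · exact absurd hmem (hup α h hα')
        · exact h
    · change latticePoint c₀ + planeMap u v 0 ∈ P
      simpa using h0
    · change latticePoint c₀ + planeMap u v (1, 0) ∈ P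
      rw [hu1, ← latticePoint_add]
      exact h1
    · change latticePoint c₂ + planeMap u v 0 ∈ P
      simpa using h2
    · change latticePoint c₂ + planeMap u v (0, 1) ∈ P
      rw [hv1, ← latticePoint_add]
      exact h3
  have hinj : Function.Injective (fun z => latticePoint c₂ + planeMap u v z) := by
    intro z z' hz
    have := add_left_cancel hz
    rw [← planeCoord_planeMap hd0 z, ← planeCoord_planeMap hd0 z', this]
  have himg := image_planeSlice_inter (P := P) hu hv hd0 hc₂
  refine hpair.not_faceRefines ?_ ?_ (h.faceRefines hu hv hd0 hc₀ hc₂)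
  · refine Set.Finite.of_finite_image ?_ hinj.injOn
    rw [himg]
    exact h.finite.image _
  · intro z hz
    have := h.hull _ hz (by
      rw [Pi.add_apply, planeMap_apply_two hu hv]
      simp [latticePoint, hc₂])
    rw [← himg] at this
    let F : ℝ × ℝ →ᵃ[ℝ] (Fin 3 → ℝ) :=
      (AffineMap.const ℝ (ℝ × ℝ) (latticePoint c₂)) + (planeMap u v).toAffineMap
    have hF : (fun z => latticePoint c₂ + planeMap u v z) = F := by
      ext z; simp [F]
    rw [hF, ← F.image_convexHull] at this
    obtain ⟨z', hz', hzz⟩ := this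
    have : z' = z := hinj ((congrFun hF z').trans hzz)
    rwa [← this]

end SlabRefines

/-! ### Pivots and descent inside one slab. -/

/-- Rounding towards zero: the remainder stays between 0 and `y`, so a strip point shifted in this
way stays in the slice by convexity. -/
theorem exists_int_abs_sub_lt_one (y : ℝ) : ∃ m : ℤ, |y - m| < 1 ∧
    (0 ≤ y - m ∧ y - m ≤ y ∨ y ≤ y - m ∧ y - m ≤ 0) := by
  rcases le_total 0 y with hy | hy
  · have h1 := Int.floor_le y
    have h2 := Int.lt_floor_add_one y
    have h3 : (0 : ℝ) ≤ ⌊y⌋ := by exact_mod_cast Int.floor_nonneg.2 hy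
    exact ⟨⌊y⌋, by rw [abs_lt]; constructor <;> linarith, Or.inl ⟨by linarith, by linarith⟩⟩
  · have h1 := Int.le_ceil y
    have h2 := Int.ceil_lt_add_one y
    have h3 : (⌈y⌉ : ℝ) ≤ 0 := by exact_mod_cast Int.ceil_le.2 (by simpa using hy)
    exact ⟨⌈y⌉, by rw [abs_lt]; constructor <;> linarith, Or.inr ⟨by linarith, by linarith⟩⟩

theorem tetraDet_eq (c : Fin 4 → Fin 3 → ℤ) : tetraDet c =
    (c 1 0 - c 0 0) * ((c 2 1 - c 0 1) * (c 3 2 - c 0 2) - (c 2 2 - c 0 2) * (c 3 1 - c 0 1)) -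
    (c 1 1 - c 0 1) * ((c 2 0 - c 0 0) * (c 3 2 - c 0 2) - (c 2 2 - c 0 2) * (c 3 0 - c 0 0)) +
    (c 1 2 - c 0 2) * ((c 2 0 - c 0 0) * (c 3 1 - c 0 1) - (c 2 1 - c 0 1) * (c 3 0 - c 0 0)) := by
  rw [tetraDet, Matrix.det_fin_three]
  simp only [Matrix.of_apply, Fin.succ_zero_eq_one, Fin.succ_one_eq_two,
    show (Fin.succ 2 : Fin 4) = 3 from rfl]
  ring

/-- A triangle of normalized area at least two contains a lattice point other than its vertices. -/
theorem Convex.exists_latticePoint_triangle {P : Set (Fin 3 → ℝ)} (hP : Convex ℝ P)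
    {a b c : Fin 3 → ℤ} (ha : latticePoint a ∈ P) (hb : latticePoint b ∈ P)
    (hc : latticePoint c ∈ P) (hab : b 2 = a 2) (hac : c 2 = a 2)
    (hd : 2 ≤ |(b 0 - a 0) * (c 1 - a 1) - (b 1 - a 1) * (c 0 - a 0)|) :
    ∃ (r : Fin 3 → ℤ) (x y z : ℝ), latticePoint r ∈ P ∧ r 2 = a 2 ∧
      latticePoint r = x • latticePoint a + y • latticePoint b + z • latticePoint c ∧
      x + y + z = 1 ∧ x < 1 ∧ y < 1 ∧ z < 1 := by
  obtain ⟨w, α, β, hw, hw2, hα, hα', hβ, hβ', h0, h1⟩ :=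
    exists_mem_triangle (u := b - a) (v := c - a) (by simp [hab]) (by simp [hac]) (by simpa using hd)
  have hr : latticePoint (a + w) =
      (1 - α - β) • latticePoint a + α • latticePoint b + β • latticePoint c := by
    rw [latticePoint_add, hw, latticePoint_sub, latticePoint_sub]
    module
  refine ⟨a + w, 1 - α - β, α, β, ?_, by simp [hw2], hr, by ring, by linarith, hα', hβ'⟩
  rw [hr]
  have := hP.sum_mem (t := Finset.univ) (w := ![1 - α - β, α, β])
    (z := ![latticePoint a, latticePoint b, latticePoint c]) ?_ ?_ ?_
  · simpa [Fin.sum_univ_three] using this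
  · intro i _
    fin_cases i
    · simp; linarith
    · simpa using hα
    · simpa using hβ
  · simp [Fin.sum_univ_three]
    ring
  · intro i _
    fin_cases i
    · simpa using ha
    · simpa using hb
    · simpa using hc

namespace SlabRefines

variable {P : Set (Fin 3 → ℝ)} {k : ℤ}

/-- The point at offset x u + y v has barycentric coordinates (1 - x, x, -y, y) when measured from
`c 0` and (-x, x, 1 - y, y) from `c 2`. A lattice point in a strip thus serves once its other
coordinate is reduced below 1 in absolute value. If `u` or `v` is not primitive, a lattice point on
that edge serves. -/
theorem exists_pivot_mixed (h : SlabRefines P k) {c : Fin 4 → Fin 3 → ℤ}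
    (hP : ∀ i, latticePoint (c i) ∈ P) (h0 : c 0 2 = k) (h1 : c 1 2 = k) (h2 : c 2 2 = k + 1)
    (h3 : c 3 2 = k + 1) (hd : 2 ≤ |tetraDet c|) :
    ∃ r : Fin 3 → ℤ, latticePoint r ∈ P ∧ (r 2 = k ∨ r 2 = k + 1) ∧ ∃ μ : Fin 4 → ℝ,
      latticePoint r = ∑ j, μ j • latticePoint (c j) ∧ ∑ j, μ j = 1 ∧ ∀ j, μ j < 1 := by
  set u := c 1 - c 0 with hu
  set v := c 3 - c 2 with hv
  have hu2 : u 2 = 0 := by simp [hu, h0, h1]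
  have hv2 : v 2 = 0 := by simp [hv, h2, h3]
  have hd' : 2 ≤ |u 0 * v 1 - u 1 * v 0| := by
    rw [tetraDet_eq, h0, h1, h2, h3, ← abs_neg] at hd
    convert hd using 2
    simp only [hu, hv, Pi.sub_apply]
    ring
  have hcu : latticePoint (c 0 + u) ∈ P := by simpa [hu] using hP 1
  have hcv : latticePoint (c 2 + v) ∈ P := by simpa [hv] using hP 3
  have hpm : ∀ (i : Fin 4) (g : Fin 3 → ℤ) (x y : ℝ), latticePoint g = planeMap u v (x, y) →
      latticePoint (c i + g) = latticePoint (c i) + ((-x) • latticePoint (c 0) +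
        x • latticePoint (c 1) + (-y) • latticePoint (c 2) + y • latticePoint (c 3)) := by
    intro i g x y hg
    rw [latticePoint_add, hg, planeMap_apply, hu, hv, latticePoint_sub, latticePoint_sub]
    module
  have hA : ∀ (x y : ℝ), (x, y) ∈ planeLattice u v → (x, y) ∈ planeSlice P (c 0) u v → 0 < x →
      x < 1 → |y| < 1 → ∃ r : Fin 3 → ℤ, latticePoint r ∈ P ∧ (r 2 = k ∨ r 2 = k + 1) ∧
      ∃ μ : Fin 4 → ℝ, latticePoint r = ∑ j, μ j • latticePoint (c j) ∧ ∑ j, μ j = 1 ∧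
        ∀ j, μ j < 1 := by
    rintro x y ⟨g, hg⟩ hxy hx hx' hy
    rw [abs_lt] at hy
    refine ⟨c 0 + g, ?_, Or.inl ?_, ![1 - x, x, -y, y], ?_, ?_, ?_⟩
    · rw [latticePoint_add, hg]
      exact hxy
    · simp [h0, apply_two_of_latticePoint_eq hu2 hv2 hg]
    · rw [hpm 0 g x y hg]
      simp [Fin.sum_univ_four]
      module
    · simp [Fin.sum_univ_four]
    · intro j
      fin_cases j
      · simpa using hx
      · simpa using hx'
      · simp; linarith
      · simpa using hy.2
  have hB : ∀ (x y : ℝ), (x, y) ∈ planeLattice u v → (x, y) ∈ planeSlice P (c 2) u v → 0 < y →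
      y < 1 → |x| < 1 → ∃ r : Fin 3 → ℤ, latticePoint r ∈ P ∧ (r 2 = k ∨ r 2 = k + 1) ∧
      ∃ μ : Fin 4 → ℝ, latticePoint r = ∑ j, μ j • latticePoint (c j) ∧ ∑ j, μ j = 1 ∧
        ∀ j, μ j < 1 := by
    rintro x y ⟨g, hg⟩ hxy hx hx' hy
    rw [abs_lt] at hy
    refine ⟨c 2 + g, ?_, Or.inr ?_, ![-x, x, 1 - y, y], ?_, ?_, ?_⟩
    · rw [latticePoint_add, hg]
      exact hxy
    · simp [h2, apply_two_of_latticePoint_eq hu2 hv2 hg]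
    · rw [hpm 2 g x y hg]
      simp [Fin.sum_univ_four]
      module
    · simp [Fin.sum_univ_four]
    · intro j
      fin_cases j
      · simp; linarith
      · simpa using hy.2
      · simpa using hx
      · simpa using hx'
  have hcA := convex_planeSlice h.convex (c 0) u v
  have hcB := convex_planeSlice h.convex (c 2) u v
  have hA0 : ((0 : ℝ), (0 : ℝ)) ∈ planeSlice P (c 0) u v := by
    simpa [planeSlice, planeMap_apply] using hP 0
  have hA1 : ((1 : ℝ), (0 : ℝ)) ∈ planeSlice P (c 0) u v := by
    simpa [planeSlice, planeMap_apply, latticePoint_add] using hcu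
  have hB0 : ((0 : ℝ), (0 : ℝ)) ∈ planeSlice P (c 2) u v := by
    simpa [planeSlice, planeMap_apply] using hP 2
  have hB1 : ((0 : ℝ), (1 : ℝ)) ∈ planeSlice P (c 2) u v := by
    simpa [planeSlice, planeMap_apply, latticePoint_add] using hcv
  have hAx : ∀ x, 0 < x → x < 1 → (x, (0 : ℝ)) ∈ planeSlice P (c 0) u v := fun x hx hx' =>
    hcA.prodMk_mem_of_horizontal hA0 hA1 hx.le hx'.le
  have hBy : ∀ y, 0 < y → y < 1 → ((0 : ℝ), y) ∈ planeSlice P (c 2) u v := fun x hx hx' =>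
    hcB.prodMk_mem_of_vertical hB0 hB1 hx.le hx'.le
  by_cases hup : ∀ x : ℝ, 0 < x → x < 1 → (x, (0 : ℝ)) ∉ planeLattice u v
  swap
  · push Not at hup
    obtain ⟨x, hx, hx', hxL⟩ := hup
    exact hA x 0 hxL (hAx x hx hx') hx hx' (by simp)
  by_cases hvp : ∀ y : ℝ, 0 < y → y < 1 → ((0 : ℝ), y) ∉ planeLattice u v
  swap
  · push Not at hvp
    obtain ⟨x, hx, hx', hxL⟩ := hvp
    exact hB 0 x hxL (hBy x hx hx') hx hx' (by simp)
  have hu1 : ((1 : ℝ), (0 : ℝ)) ∈ planeLattice u v := ⟨u, by simp [planeMap_apply]⟩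
  have hv1 : ((0 : ℝ), (1 : ℝ)) ∈ planeLattice u v := ⟨v, by simp [planeMap_apply]⟩
  rcases h.exists_strip_mem hu2 hv2 hd' h0 h2 (hP 0) hcu (hP 2) hcv hup hvp with
    ⟨x, y, hL, hS, hx, hx'⟩ | ⟨x, y, hL, hS, hx, hx'⟩
  · obtain ⟨m, hm, hm'⟩ := exists_int_abs_sub_lt_one y
    refine hA x (y - m) ?_ ?_ hx hx' hm
    · have := (planeLattice u v).sub_mem hL ((planeLattice u v).zsmul_mem hv1 m)
      simpa using this
    · rcases hm' with ⟨h1, h2⟩ | ⟨h1, h2⟩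
      · exact hcA.prodMk_mem_of_vertical (hAx x hx hx') hS h1 h2
      · exact hcA.prodMk_mem_of_vertical hS (hAx x hx hx') h1 h2
  · obtain ⟨m, hm, hm'⟩ := exists_int_abs_sub_lt_one x
    refine hB (x - m) y ?_ ?_ hx hx' hm
    · have := (planeLattice u v).sub_mem hL ((planeLattice u v).zsmul_mem hu1 m)
      simpa using this
    · rcases hm' with ⟨h1, h2⟩ | ⟨h1, h2⟩
      · exact hcB.prodMk_mem_of_horizontal (hBy y hx hx') hS h1 h2
      · exact hcB.prodMk_mem_of_horizontal hS (hBy y hx hx') h1 h2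

/-- Sorted heights leave the splits 3+1, 2+2 and 1+3; four vertices at one height have determinant
zero. In the triangular cases the remaining vertex gets coordinate 0. -/
theorem exists_pivot_of_monotone (h : SlabRefines P k) {c : Fin 4 → Fin 3 → ℤ}
    (hP : ∀ i, latticePoint (c i) ∈ P) (hc : ∀ i, c i 2 = k ∨ c i 2 = k + 1)
    (hmono : Monotone fun i => c i 2) (hd : 2 ≤ |tetraDet c|) :
    ∃ r : Fin 3 → ℤ, latticePoint r ∈ P ∧ (r 2 = k ∨ r 2 = k + 1) ∧ ∃ μ : Fin 4 → ℝ,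
      latticePoint r = ∑ j, μ j • latticePoint (c j) ∧ ∑ j, μ j = 1 ∧ ∀ j, μ j < 1 := by
  have m01 : c 0 2 ≤ c 1 2 := hmono (by decide)
  have m12 : c 1 2 ≤ c 2 2 := hmono (by decide)
  have m23 : c 2 2 ≤ c 3 2 := hmono (by decide)
  rcases hc 1 with h1 | h1
  · have h0 : c 0 2 = k := by rcases hc 0 with h | h <;> omega
    rcases hc 2 with h2 | h2
    · rcases hc 3 with h3 | h3
      · rw [tetraDet_eq, h0, h1, h2, h3] at hd
        simp at hd
      · obtain ⟨r, x, y, z, hr, hr2, hre, hs, hx, hy, hz⟩ :=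
          h.convex.exists_latticePoint_triangle (hP 0) (hP 1) (hP 2) (h1.trans h0.symm)
            (h2.trans h0.symm) (by
              rw [tetraDet_eq, h0, h1, h2, h3] at hd
              convert hd using 2
              ring)
        refine ⟨r, hr, Or.inl (hr2.trans h0), ![x, y, z, 0], ?_, ?_, ?_⟩
        · rw [hre]; simp [Fin.sum_univ_four]
        · simpa [Fin.sum_univ_four] using hs
        · intro j
          fin_cases j
          · simpa using hx
          · simpa using hy
          · simpa using hz
          · simp
    · exact h.exists_pivot_mixed hP h0 h1 h2 (by rcases hc 3 with h | h <;> omega) hd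
  · have h2 : c 2 2 = k + 1 := by rcases hc 2 with h | h <;> omega
    have h3 : c 3 2 = k + 1 := by rcases hc 3 with h | h <;> omega
    rcases hc 0 with h0 | h0
    · obtain ⟨r, x, y, z, hr, hr2, hre, hs, hx, hy, hz⟩ :=
          h.convex.exists_latticePoint_triangle (hP 1) (hP 2) (hP 3) (h2.trans h1.symm)
            (h3.trans h1.symm) (by
              rw [tetraDet_eq, h0, h1, h2, h3] at hd
              convert hd using 2
              ring)
      refine ⟨r, hr, Or.inr (hr2.trans h1), ![0, x, y, z], ?_, ?_, ?_⟩
      · rw [hre]; simp [Fin.sum_univ_four]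
      · simpa [Fin.sum_univ_four] using hs
      · intro j
        fin_cases j
        · simp
        · simpa using hx
        · simpa using hy
        · simpa using hz
    · rw [tetraDet_eq, h0, h1, h2, h3] at hd
      simp at hd

theorem exists_unimodular (h : SlabRefines P k) {c : Fin 4 → Fin 3 → ℤ}
    (hP : ∀ i, latticePoint (c i) ∈ P) (hc : ∀ i, c i 2 = k ∨ c i 2 = k + 1)
    (hd : tetraDet c ≠ 0) {y : Fin 3 → ℝ} (hy : y ∈ tetra c) :
    ∃ c' : Fin 4 → Fin 3 → ℤ, (∀ i, latticePoint (c' i) ∈ P) ∧ IsUnit (tetraDet c') ∧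
      y ∈ tetra c' := by
  obtain ⟨c', hc', h1, h2⟩ := exists_unimodular_tetra
    (S := {g | latticePoint g ∈ P ∧ (g 2 = k ∨ g 2 = k + 1)}) (y := y) (c := c) (by
      intro c hc hd
      set σ := Tuple.sort fun i => c i 2
      obtain ⟨r, hrP, hr2, μ, hr, hμ, hlt⟩ := h.exists_pivot_of_monotone (c := c ∘ σ)
        (fun i => (hc (σ i)).1) (fun i => (hc (σ i)).2) (Tuple.monotone_sort fun i => c i 2)
        (by rwa [tetraDet_comp_perm])
      refine ⟨r, ⟨hrP, hr2⟩, μ ∘ σ.symm, ?_, ?_, fun j => hlt _⟩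
      · rw [hr, ← Equiv.sum_comp σ fun j => (μ ∘ σ.symm) j • latticePoint (c j)]
        simp
      · rw [← hμ, ← Equiv.sum_comp σ]
        simp)
    (fun i => ⟨hP i, hc i⟩) hd hy
  exact ⟨c', fun i => (hc' i).1, h1, h2⟩

end SlabRefines

/-! ### Full-dimensional tetrahedra through a point. -/

/-- The homogeneous coordinates of a lattice point. -/
def homCoord (g : Fin 3 → ℤ) : Fin 4 → ℝ := Fin.cons 1 (latticePoint g)

theorem linearIndependent_homCoord_iff {c : Fin 4 → Fin 3 → ℤ} :
    LinearIndependent ℝ (fun i => homCoord (c i)) ↔ tetraDet c ≠ 0 := by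
  have : (fun i => homCoord (c i)) = (homMatrix c).row := rfl
  rw [this, Matrix.linearIndependent_rows_iff_isUnit, Matrix.isUnit_iff_isUnit_det,
    det_homMatrix, isUnit_iff_ne_zero]
  exact_mod_cast Iff.rfl

/-- A full-dimensional version of Carathéodory's theorem. -/
theorem exists_tetra_of_mem_convexHull {S : Set (Fin 3 → ℤ)} {c₀ : Fin 4 → Fin 3 → ℤ}
    (hc₀ : ∀ i, c₀ i ∈ S) (hd : tetraDet c₀ ≠ 0) {x : Fin 3 → ℝ}
    (hx : x ∈ convexHull ℝ (latticePoint '' S)) :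
    ∃ c : Fin 4 → Fin 3 → ℤ, (∀ i, c i ∈ S) ∧ tetraDet c ≠ 0 ∧ x ∈ tetra c := by
  rw [convexHull_eq_union] at hx
  simp only [Set.mem_iUnion] at hx
  obtain ⟨t, htS, hti, hxt⟩ := hx
  set t' : Set (Fin 3 → ℤ) := latticePoint ⁻¹' (t : Set (Fin 3 → ℝ)) with ht'
  have htt' : (t : Set (Fin 3 → ℝ)) ⊆ latticePoint '' t' := by
    intro z hz
    obtain ⟨g, -, rfl⟩ := htS hz
    exact ⟨g, hz, rfl⟩
  have ht'S : t' ⊆ S := by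
    intro g hg
    obtain ⟨g', hg', h⟩ := htS hg
    rwa [← latticePoint_injective h]
  have hli : LinearIndepOn ℝ homCoord t' := by
    have hp : AffineIndependent ℝ (fun g : t' => latticePoint g.1) :=
      hti.comp_embedding ⟨fun g : t' => (⟨latticePoint g.1, g.2⟩ : t), fun g g' h =>
        Subtype.ext (latticePoint_injective (congrArg Subtype.val h))⟩
    rw [affineIndependent_iff] at hp
    refine linearIndependent_iff'.2 fun s w hw => hp s w ?_ ?_
    · simpa [homCoord] using congrFun hw 0
    · ext i
      simpa [homCoord] using congrFun hw i.succ
  -- The affinely independent set from Carathéodory's theorem is linearly independent in homogeneous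
  -- coordinates; it is completed inside `S`, which spans because of `c₀`.
  obtain ⟨b, hbS, htb, hspan, hbi⟩ := exists_linearIndepOn_extension hli ht'S
  have htop : (⊤ : Submodule ℝ (Fin 4 → ℝ)) ≤ Submodule.span ℝ (homCoord '' b) := by
    have h1 := (linearIndependent_homCoord_iff.2 hd).span_eq_top_of_card_eq_finrank (by simp)
    rw [← h1, Submodule.span_le]
    rintro _ ⟨i, rfl⟩
    exact hspan ⟨_, hc₀ i, rfl⟩
  let B : Module.Basis b ℝ (Fin 4 → ℝ) := Module.Basis.mk hbi (by
    rw [Set.image_eq_range] at htop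
    exact htop)
  let e : Fin 4 ≃ b := (Pi.basisFun ℝ (Fin 4)).indexEquiv B
  refine ⟨fun i => e i, fun i => hbS (e i).2, ?_, ?_⟩
  · exact linearIndependent_homCoord_iff.1 (hbi.comp e e.injective)
  · refine convexHull_mono ?_ hxt
    refine htt'.trans ?_
    rintro _ ⟨g, hg, rfl⟩
    exact ⟨e.symm ⟨g, htb hg⟩, by simp⟩

/-! ### Smooth prismatoids in normalized coordinates. -/

/-- The coordinate forms of the basis formed by the rows of an integer matrix. -/
noncomputable def dualForm (M : Matrix (Fin 3) (Fin 3) ℤ) (i : Fin 3) : (Fin 3 → ℝ) →ₗ[ℝ] ℝ :=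
  ∑ j, ((M⁻¹ j i : ℤ) : ℝ) • LinearMap.proj j

theorem dualForm_apply (M : Matrix (Fin 3) (Fin 3) ℤ) (i : Fin 3) (x : Fin 3 → ℝ) :
    dualForm M i x = ∑ j, x j * (M⁻¹ j i : ℤ) := by
  simp [dualForm, mul_comm]

theorem dualForm_latticePoint (M : Matrix (Fin 3) (Fin 3) ℤ) (i : Fin 3) (g : Fin 3 → ℤ) :
    dualForm M i (latticePoint g) = ((∑ j, g j * M⁻¹ j i : ℤ) : ℝ) := by
  simp [dualForm_apply, latticePoint]

theorem dualForm_row {M : Matrix (Fin 3) (Fin 3) ℤ} (hM : IsUnit M.det) (i k : Fin 3) :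
    dualForm M i (latticePoint (M k)) = if k = i then 1 else 0 := by
  rw [dualForm_latticePoint]
  have := congrFun (congrFun (Matrix.mul_nonsing_inv M hM) k) i
  rw [Matrix.mul_apply] at this
  rw [this, Matrix.one_apply]
  split_ifs <;> simp

theorem sum_dualForm_smul {M : Matrix (Fin 3) (Fin 3) ℤ} (hM : IsUnit M.det) (x : Fin 3 → ℝ) :
    ∑ i, dualForm M i x • latticePoint (M i) = x := by
  ext l
  have h : ∀ j, ∑ i, ((M⁻¹ j i : ℤ) : ℝ) * (M i l : ℤ) = if j = l then 1 else 0 := by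
    intro j
    have := congrFun (congrFun (Matrix.nonsing_inv_mul M hM) j) l
    rw [Matrix.mul_apply, Matrix.one_apply] at this
    have h2 := congrArg (Int.cast : ℤ → ℝ) this
    push_cast at h2
    exact h2
  simp only [Finset.sum_apply, Pi.smul_apply, smul_eq_mul, dualForm_apply, latticePoint,
    Finset.sum_mul]
  rw [Finset.sum_comm]
  simp only [mul_assoc, ← Finset.mul_sum, h]
  simp

theorem finite_setOf_latticePoint_mem {d : ℕ} {P : Set (Fin d → ℝ)} (hP : Bornology.IsBounded P) :
    {g : Fin d → ℤ | latticePoint g ∈ P}.Finite := by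
  obtain ⟨R, hR⟩ := hP.subset_closedBall 0
  refine (Set.finite_Icc (fun _ : Fin d => -⌈R⌉) (fun _ => ⌈R⌉)).subset fun g hg => ?_
  have h1 := hR hg
  rw [mem_closedBall_zero_iff] at h1
  have h2 : ∀ i, |(g i : ℝ)| ≤ ⌈R⌉ := fun i =>
    ((norm_le_pi_norm (latticePoint g) i).trans h1).trans (Int.le_ceil R)
  have h3 : ∀ i, |g i| ≤ ⌈R⌉ := fun i => by exact_mod_cast h2 i
  exact ⟨fun i => (abs_le.1 (h3 i)).1, fun i => (abs_le.1 (h3 i)).2⟩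

/-- The local structure of a smooth prismatoid between the heights `0` and `N`: the set `V` of the
vertices at height `0`, and at each of them a lattice basis whose cone contains the prismatoid. -/
structure PrismData (P : Set (Fin 3 → ℝ)) (N : ℕ) (V : Set (Fin 3 → ℤ))
    (b : (Fin 3 → ℤ) → Matrix (Fin 3) (Fin 3) ℤ) : Prop where
  convex : Convex ℝ P
  isBounded : Bornology.IsBounded P
  pos : 0 < N
  height : ∀ x ∈ P, 0 ≤ x 2 ∧ x 2 ≤ N
  base_max : ∀ f : (Fin 3 → ℝ) →ₗ[ℝ] ℝ, ∃ v ∈ V, ∀ x ∈ P, x 2 = 0 → f x ≤ f (latticePoint v)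
  mem : ∀ v ∈ V, latticePoint v ∈ P
  base : ∀ v ∈ V, v 2 = 0
  dir_zero : ∀ v ∈ V, b v 0 2 = 0
  dir_one : ∀ v ∈ V, b v 1 2 = 0
  dir_two : ∀ v ∈ V, b v 2 2 = 1
  det : ∀ v ∈ V, IsUnit (b v).det
  cone : ∀ v ∈ V, ∀ x ∈ P, ∀ i, 0 ≤ dualForm (b v) i (x - latticePoint v)
  top_mem : ∀ v ∈ V, latticePoint v + (N : ℝ) • latticePoint (b v 2) ∈ P
  next_mem : ∀ v ∈ V, ∀ i, i ≠ 2 → ∃ t : ℕ, 0 < t ∧ v + t • b v i ∈ V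

namespace PrismData

variable {P : Set (Fin 3 → ℝ)} {N : ℕ} {V : Set (Fin 3 → ℤ)}
  {b : (Fin 3 → ℤ) → Matrix (Fin 3) (Fin 3) ℤ} {v : Fin 3 → ℤ}

theorem finite (h : PrismData P N V b) : {g : Fin 3 → ℤ | latticePoint g ∈ P}.Finite :=
  finite_setOf_latticePoint_mem h.isBounded

theorem dualForm_two (h : PrismData P N V b) (hv : v ∈ V) (x : Fin 3 → ℝ) :
    dualForm (b v) 2 x = x 2 := by
  have := congrFun (sum_dualForm_smul (h.det v hv) x) 2
  simpa [Fin.sum_univ_three, latticePoint, h.dir_zero v hv, h.dir_one v hv, h.dir_two v hv]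
    using this

theorem decomp (h : PrismData P N V b) (hv : v ∈ V) {i j : Fin 3}
    (hij : i = 0 ∧ j = 1 ∨ i = 1 ∧ j = 0) (x : Fin 3 → ℝ) :
    x = latticePoint v + dualForm (b v) i (x - latticePoint v) • latticePoint (b v i) +
      dualForm (b v) j (x - latticePoint v) • latticePoint (b v j) +
      x 2 • latticePoint (b v 2) := by
  have h1 := sum_dualForm_smul (h.det v hv) (x - latticePoint v)
  rw [Fin.sum_univ_three, h.dualForm_two hv] at h1
  have h2 : (x - latticePoint v) 2 = x 2 := by simp [latticePoint, h.base v hv]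
  rw [h2] at h1
  rcases hij with ⟨rfl, rfl⟩ | ⟨rfl, rfl⟩
  · rw [add_assoc, add_assoc, ← add_assoc (dualForm _ _ _ • _), h1]; abel
  · rw [add_assoc, add_assoc, ← add_assoc (dualForm _ _ _ • _),
      add_comm (dualForm (b v) 1 _ • _), h1]; abel

theorem vertical_mem (h : PrismData P N V b) (hv : v ∈ V) {s : ℝ} (hs : 0 ≤ s) (hs' : s ≤ N) :
    latticePoint v + s • latticePoint (b v 2) ∈ P := by
  have hN : (0 : ℝ) < N := by exact_mod_cast h.pos
  have := (h.convex) (h.mem v hv) (h.top_mem v hv) (a := 1 - s / N) (b := s / N)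
    (by rw [sub_nonneg, div_le_one hN]; exact hs') (by positivity) (by ring)
  convert this using 1
  rw [smul_add, smul_smul, div_mul_cancel₀ _ hN.ne']
  module

theorem segment_mem (h : PrismData P N V b) (hv : v ∈ V) {i : Fin 3} (hi : i ≠ 2) :
    ∃ t : ℝ, 0 < t ∧ latticePoint v + t • latticePoint (b v i) ∈ P := by
  obtain ⟨t, ht, hm⟩ := h.next_mem v hv i hi
  refine ⟨t, by exact_mod_cast ht, ?_⟩
  rw [← latticePoint_nsmul, ← latticePoint_add]
  exact h.mem _ hm

theorem form_dir_nonneg (h : PrismData P N V b) (hv : v ∈ V) {f : (Fin 3 → ℝ) →ₗ[ℝ] ℝ}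
    (hf : ∀ x ∈ P, f (latticePoint v) ≤ f x) {i : Fin 3} (hi : i ≠ 2) :
    0 ≤ f (latticePoint (b v i)) := by
  obtain ⟨t, ht, hm⟩ := h.segment_mem hv hi
  have := hf _ hm
  rw [map_add, map_smul, smul_eq_mul] at this
  by_contra! h0
  nlinarith

/-- The facet over the edge in direction `b v j` has a unit lattice segment at every height below
the top. -/
theorem side_edge_mem (h : PrismData P N V b) (hv : v ∈ V) {i j : Fin 3}
    (hij : i = 0 ∧ j = 1 ∨ i = 1 ∧ j = 0) {k : ℕ} (hk : k < N) :
    latticePoint v + (k : ℝ) • latticePoint (b v 2) + latticePoint (b v j) ∈ P := by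
  have hi2 : i ≠ 2 := by rcases hij with ⟨rfl, rfl⟩ | ⟨rfl, rfl⟩ <;> decide
  have hj2 : j ≠ 2 := by rcases hij with ⟨rfl, rfl⟩ | ⟨rfl, rfl⟩ <;> decide
  have hijne : i ≠ j := by rcases hij with ⟨rfl, rfl⟩ | ⟨rfl, rfl⟩ <;> decide
  have hN : (0 : ℝ) < N := by exact_mod_cast h.pos
  have hdet := h.det v hv
  obtain ⟨t, ht, hv₁⟩ := h.next_mem v hv j hj2
  set v₁ := v + t • b v j with hv₁def
  set γ := dualForm (b v) i with hγ
  have hlp : latticePoint v₁ = latticePoint v + (t : ℝ) • latticePoint (b v j) := by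
    rw [hv₁def, latticePoint_add, latticePoint_nsmul]
  have hγv : γ (latticePoint v₁) = γ (latticePoint v) := by
    rw [hlp, map_add, map_smul, hγ, dualForm_row hdet, if_neg hijne.symm]
    simp
  have hγP : ∀ x ∈ P, γ (latticePoint v) ≤ γ x := by
    intro x hx
    have := h.cone v hv x hx i
    rw [map_sub] at this
    linarith
  have hγP₁ : ∀ x ∈ P, γ (latticePoint v₁) ≤ γ x := by rwa [hγv]
  have h0 := h.form_dir_nonneg hv₁ hγP₁ (i := 0) (by decide)
  have h1 := h.form_dir_nonneg hv₁ hγP₁ (i := 1) (by decide)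
  have h2 : 0 ≤ γ (latticePoint (b v₁ 2)) := by
    have := hγP₁ _ (h.top_mem v₁ hv₁)
    rw [map_add, map_smul, smul_eq_mul] at this
    by_contra! h0
    nlinarith
  -- The top end of the edge rising from `v` minimizes `γ`. Expanded at the neighbouring vertex
  -- `v₁`, it has only nonnegative contributions, so the one along `b v₁ 2`, with factor `N > 0`,
  -- vanishes: the edge rising from `v₁` lies in the same side facet.
  have hγ2 : γ (latticePoint (b v₁ 2)) = 0 := by
    have hx := h.top_mem v hv
    obtain ⟨x, hxdef⟩ : ∃ x, x = latticePoint v + (N : ℝ) • latticePoint (b v 2) := ⟨_, rfl⟩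
    rw [← hxdef] at hx
    have hγx : γ x = γ (latticePoint v) := by
      rw [hxdef, map_add, map_smul, hγ, dualForm_row hdet, if_neg hi2.symm]
      simp
    have hx2 : x 2 = N := by
      simp [hxdef, latticePoint, h.base v hv, h.dir_two v hv]
    have h3 := h.decomp hv₁ (Or.inl ⟨rfl, rfl⟩) x
    have h4 := congrArg γ h3
    rw [map_add, map_add, map_add, map_smul, map_smul, map_smul, hγx, hγv, hx2] at h4
    simp only [smul_eq_mul] at h4
    have c0 := h.cone v₁ hv₁ x hx 0
    have c1 := h.cone v₁ hv₁ x hx 1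
    have p0 := mul_nonneg c0 h0
    have p1 := mul_nonneg c1 h1
    have p2 := mul_nonneg hN.le h2
    have : (N : ℝ) * γ (latticePoint (b v₁ 2)) = 0 := by linarith
    exact (mul_eq_zero.1 this).resolve_left hN.ne'
  obtain ⟨e, he⟩ : ∃ e : ℤ, dualForm (b v) j (latticePoint (b v₁ 2)) = e :=
    ⟨_, dualForm_latticePoint _ _ _⟩
  have hb2 : latticePoint (b v₁ 2) =
      latticePoint (b v 2) + (e : ℝ) • latticePoint (b v j) := by
    have h3 := sum_dualForm_smul hdet (latticePoint (b v₁ 2))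
    have h4 : dualForm (b v) 2 (latticePoint (b v₁ 2)) = 1 := by
      rw [h.dualForm_two hv]
      simp [latticePoint, h.dir_two v₁ hv₁]
    rw [← h3, Fin.sum_univ_three, h4]
    rcases hij with ⟨rfl, rfl⟩ | ⟨rfl, rfl⟩
    · rw [hγ] at hγ2
      rw [hγ2, he]
      module
    · rw [hγ] at hγ2
      rw [hγ2, he]
      module
  have hte : (0 : ℝ) ≤ t + N * e := by
    have := h.cone v hv _ (h.top_mem v₁ hv₁) j
    rw [hlp, add_sub_right_comm, add_sub_cancel_left, map_add, map_smul, map_smul, he,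
      dualForm_row hdet, if_pos rfl] at this
    simpa using this
  -- The side has lattice length `t + k * e` at height `k`: positive at 0 and nonnegative at `N`,
  -- hence positive for `k < N`, and an integer.
  have hm : (1 : ℝ) ≤ t + k * e := by
    have hk' : (k : ℝ) + 1 ≤ N := by exact_mod_cast hk
    have ht' : (1 : ℝ) ≤ t := by exact_mod_cast ht
    have hpos : (0 : ℝ) < t + k * e := by
      have hk0 : (0 : ℝ) ≤ k := k.cast_nonneg
      have : 0 < (N : ℝ) * (t + k * e) := by nlinarith
      by_contra! h0
      nlinarith
    have : (0 : ℤ) < t + k * e := by exact_mod_cast hpos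
    have : (1 : ℤ) ≤ t + k * e := by omega
    exact_mod_cast this
  have hkN : (k : ℝ) ≤ N := by exact_mod_cast hk.le
  have hs := h.vertical_mem hv k.cast_nonneg hkN
  have he := h.vertical_mem hv₁ k.cast_nonneg hkN
  have hm0 : (0 : ℝ) < t + k * e := by linarith
  have := (h.convex) hs he (a := 1 - 1 / (t + k * e)) (b := 1 / (t + k * e))
    (by rw [sub_nonneg, div_le_one hm0]; exact hm) (by positivity) (by ring)
  convert this using 1
  rw [hlp, hb2]
  have h5 : latticePoint (b v j) = (1 / (t + k * e) * (t + k * e) : ℝ) • latticePoint (b v j) := by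
    rw [one_div_mul_cancel hm0.ne', one_smul]
  nth_rewrite 1 [h5]
  module

/-- A vertex maximizing a form on the base also does so at all heights. -/
theorem form_le (h : PrismData P N V b) (hv : v ∈ V) {f : (Fin 3 → ℝ) →ₗ[ℝ] ℝ}
    (hf : ∀ x ∈ P, x 2 = 0 → f x ≤ f (latticePoint v)) {x : Fin 3 → ℝ} (hx : x ∈ P) :
    f x ≤ f (latticePoint v + x 2 • latticePoint (b v 2)) := by
  have hneg : ∀ i, i ≠ 2 → b v i 2 = 0 → f (latticePoint (b v i)) ≤ 0 := by
    intro i hi hi2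
    obtain ⟨t, ht, hm⟩ := h.segment_mem hv hi
    have := hf _ hm (by simp [latticePoint, hi2, h.base v hv])
    rw [map_add, map_smul, smul_eq_mul] at this
    by_contra! h0
    nlinarith
  have h0 := hneg 0 (by decide) (h.dir_zero v hv)
  have h1 := hneg 1 (by decide) (h.dir_one v hv)
  have h3 := congrArg f (h.decomp hv (Or.inl ⟨rfl, rfl⟩) x)
  rw [map_add, map_add, map_add, map_smul, map_smul, map_smul] at h3
  simp only [smul_eq_mul] at h3
  rw [map_add, map_smul, smul_eq_mul]
  have c0 := h.cone v hv x hx 0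
  have c1 := h.cone v hv x hx 1
  have p0 := mul_nonneg c0 (neg_nonneg.2 h0)
  have p1 := mul_nonneg c1 (neg_nonneg.2 h1)
  linarith

theorem latticePoint_vertical_mem (h : PrismData P N V b) (hv : v ∈ V) {k : ℕ} (hk : k ≤ N) :
    latticePoint (v + k • b v 2) ∈ P ∧ (v + k • b v 2) 2 = k := by
  constructor
  · rw [latticePoint_add, latticePoint_nsmul]
    exact h.vertical_mem hv k.cast_nonneg (by exact_mod_cast hk)
  · simp [h.base v hv, h.dir_two v hv]

/-- The part of the prismatoid between two integer heights is spanned by the lattice points at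
these heights. -/
theorem mem_convexHull (h : PrismData P N V b) {i j : ℕ} (hi : i ≤ N) (hj : j ≤ N)
    {x : Fin 3 → ℝ} (hx : x ∈ P) (hxi : (i : ℝ) ≤ x 2) (hxj : x 2 ≤ j) :
    x ∈ convexHull ℝ (latticePoint '' {g : Fin 3 → ℤ | latticePoint g ∈ P ∧
      (g 2 = i ∨ g 2 = j)}) := by
  by_contra hcon
  have hfin : {g : Fin 3 → ℤ | latticePoint g ∈ P ∧ (g 2 = i ∨ g 2 = j)}.Finite :=
    h.finite.subset fun g hg => hg.1
  -- At the height of `x`, the form `f` is largest on the edge rising from a maximizer on the base.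
  -- Along that edge it is affine, hence bounded by its values at the lattice points at heights `i`
  -- and `j`.
  obtain ⟨f, s, hs, hsx⟩ := geometric_hahn_banach_closed_point (convex_convexHull ℝ _)
    ((hfin.image latticePoint).isCompact_convexHull ℝ).isClosed hcon
  obtain ⟨v, hv, hmax⟩ := h.base_max (f : (Fin 3 → ℝ) →ₗ[ℝ] ℝ)
  have hle := h.form_le hv hmax hx
  obtain ⟨mi, mi2⟩ := h.latticePoint_vertical_mem hv hi
  obtain ⟨mj, mj2⟩ := h.latticePoint_vertical_mem hv hj
  have hsi := hs _ (subset_convexHull ℝ _ ⟨_, ⟨mi, Or.inl mi2⟩, rfl⟩)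
  have hsj := hs _ (subset_convexHull ℝ _ ⟨_, ⟨mj, Or.inr mj2⟩, rfl⟩)
  rw [latticePoint_add, latticePoint_nsmul, map_add, map_smul, smul_eq_mul] at hsi hsj
  rw [map_add, map_smul, smul_eq_mul] at hle
  simp only [ContinuousLinearMap.coe_coe] at hle
  rcases le_total 0 (f (latticePoint (b v 2))) with h0 | h0
  · nlinarith
  · nlinarith

end PrismData

namespace PrismData

variable {P : Set (Fin 3 → ℝ)} {N : ℕ} {V : Set (Fin 3 → ℤ)}
  {b : (Fin 3 → ℤ) → Matrix (Fin 3) (Fin 3) ℤ} {v : Fin 3 → ℤ}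

/-- Moved up its edge, `v` still maximizes `f`. The strict decrease along `b v i` puts `Q` and `R`
on the ray in direction `b v j`, so `w` is `b v j` up to sign, and `side_edge_mem` provides it at
height `k`. -/
theorem refines_of_dir_neg (h : PrismData P N V b) (hv : v ∈ V) {i j : Fin 3}
    (hij : i = 0 ∧ j = 1 ∨ i = 1 ∧ j = 0) {k : ℕ} (hk : k < N) {f : (Fin 3 → ℝ) →ₗ[ℝ] ℝ}
    (hf : ∀ x ∈ P, x 2 = 0 → f x ≤ f (latticePoint v)) (hi : f (latticePoint (b v i)) < 0)
    {Q R : Fin 3 → ℤ} (hQ : Q 2 = k + 1) (hR : R 2 = k + 1) (hQP : latticePoint Q ∈ P)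
    (hRP : latticePoint R ∈ P) (hQR : Q ≠ R)
    (hQm : ∀ x ∈ P, x 2 = k + 1 → f x ≤ f (latticePoint Q))
    (hRm : ∀ x ∈ P, x 2 = k + 1 → f x ≤ f (latticePoint R)) :
    ∃ w : Fin 3 → ℤ, w 2 = 0 ∧ (∃ m : ℕ, R - Q = m • w) ∧ ∃ p : Fin 3 → ℤ, p 2 = k ∧
      latticePoint p ∈ P ∧ latticePoint (p + w) ∈ P ∧
      ∀ x ∈ P, x 2 = k → f x ≤ f (latticePoint p) := by
  have hj2 : j ≠ 2 := by rcases hij with ⟨rfl, rfl⟩ | ⟨rfl, rfl⟩ <;> decide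
  have hjz : b v j 2 = 0 := by
    rcases hij with ⟨rfl, rfl⟩ | ⟨rfl, rfl⟩
    · exact h.dir_one v hv
    · exact h.dir_zero v hv
  have hjle : f (latticePoint (b v j)) ≤ 0 := by
    obtain ⟨t, ht, hm⟩ := h.segment_mem hv hj2
    have := hf _ hm (by simp [latticePoint, hjz, h.base v hv])
    rw [map_add, map_smul, smul_eq_mul] at this
    by_contra! h0
    nlinarith
  have key : ∀ Q : Fin 3 → ℤ, Q 2 = k + 1 → latticePoint Q ∈ P →
      (∀ x ∈ P, x 2 = k + 1 → f x ≤ f (latticePoint Q)) →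
      ∃ q : ℤ, 0 ≤ q ∧ q * f (latticePoint (b v j)) = 0 ∧
        Q = v + q • b v j + (k + 1) • b v 2 := by
    intro Q hQ hQP hQm
    obtain ⟨q, hq⟩ : ∃ q : ℤ, dualForm (b v) j (latticePoint (Q - v)) = q :=
      ⟨_, dualForm_latticePoint _ _ _⟩
    have hdec := h.decomp hv hij (latticePoint Q)
    rw [← latticePoint_sub, hq] at hdec
    have ci := h.cone v hv _ hQP i
    have cj := h.cone v hv _ hQP j
    rw [← latticePoint_sub] at ci cj
    rw [hq] at cj
    have hQ2 : latticePoint Q 2 = (k : ℝ) + 1 := by simp [latticePoint, hQ]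
    rw [hQ2] at hdec
    obtain ⟨mt, mt2⟩ := h.latticePoint_vertical_mem hv (k := k + 1) hk
    have h1 := hQm _ mt (by
      have : ((v + (k + 1) • b v 2) 2 : ℝ) = (((k + 1 : ℕ) : ℤ) : ℝ) := congrArg _ mt2
      simpa [latticePoint] using this)
    have h2 := congrArg f hdec
    rw [latticePoint_add, latticePoint_nsmul, map_add, map_smul] at h1
    rw [map_add, map_add, map_add, map_smul, map_smul, map_smul] at h2
    simp only [smul_eq_mul] at h1 h2
    push_cast at h1
    have p1 := mul_nonneg ci (neg_nonneg.2 hi.le)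
    have p2 := mul_nonneg cj (neg_nonneg.2 hjle)
    have e1 : dualForm (b v) i (latticePoint (Q - v)) * f (latticePoint (b v i)) = 0 := by linarith
    have e2 : q * f (latticePoint (b v j)) = 0 := by linarith
    refine ⟨q, by exact_mod_cast cj, e2, latticePoint_injective ?_⟩
    rw [hdec, (mul_eq_zero.1 e1).resolve_right hi.ne, latticePoint_add, latticePoint_add,
      latticePoint_zsmul, latticePoint_nsmul]
    push_cast
    module
  obtain ⟨q, hq0, hq, hQe⟩ := key Q hQ hQP hQm
  obtain ⟨r, hr0, hr, hRe⟩ := key R hR hRP hRm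
  have hqr : q ≠ r := by
    rintro rfl
    exact hQR (hQe.trans hRe.symm)
  have hfj : f (latticePoint (b v j)) = 0 := by
    by_contra hne
    have h1 := (mul_eq_zero.1 hq).resolve_right hne
    have h2 := (mul_eq_zero.1 hr).resolve_right hne
    have h1 : q = 0 := by exact_mod_cast h1
    have h2 : r = 0 := by exact_mod_cast h2
    exact hqr (h1.trans h2.symm)
  have hRQ : R - Q = (r - q) • b v j := by
    rw [hRe, hQe, sub_smul]; abel
  obtain ⟨mp, mp2⟩ := h.latticePoint_vertical_mem hv hk.le
  have mp' : latticePoint (v + k • b v 2 + b v j) ∈ P := by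
    rw [latticePoint_add, latticePoint_add, latticePoint_nsmul]
    exact h.side_edge_mem hv hij hk
  have hmax : ∀ x ∈ P, x 2 = k → f x ≤ f (latticePoint (v + k • b v 2)) := by
    intro x hx hxk
    have := h.form_le hv hf hx
    rwa [hxk, ← latticePoint_nsmul, ← latticePoint_add] at this
  -- The multiplier is a natural number, so `w` must point from `Q` to `R`; in the second case the
  -- segment is traversed backwards.
  rcases lt_or_gt_of_ne hqr with hlt | hlt
  · refine ⟨b v j, hjz, ⟨(r - q).toNat, ?_⟩, v + k • b v 2, mp2, mp, mp', hmax⟩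
    rw [hRQ, ← natCast_zsmul, Int.toNat_of_nonneg (by omega)]
  · refine ⟨-b v j, by simp [hjz], ⟨(q - r).toNat, ?_⟩, v + k • b v 2 + b v j, ?_, mp', ?_, ?_⟩
    · rw [hRQ, ← natCast_zsmul, Int.toNat_of_nonneg (by omega), smul_neg, ← neg_smul, neg_sub]
    · rw [Pi.add_apply, mp2, hjz, add_zero]
    · rwa [add_neg_cancel_right]
    · intro x hx hxk
      rw [latticePoint_add, map_add, hfj, add_zero]
      exact hmax x hx hxk

theorem slabRefines (h : PrismData P N V b) {k : ℕ} (hk : k < N) : SlabRefines P k := by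
  refine ⟨h.convex, h.finite.subset fun g hg => hg.1, ?_, ?_⟩
  · intro x hx hxk
    have := h.mem_convexHull (i := k + 1) (j := k + 1) hk hk hx (by rw [hxk]; simp)
      (by rw [hxk]; simp)
    simpa using this
  · rintro f ⟨z, hz, hfz⟩ Q R hQ hR hQP hRP hQR hQm hRm
    obtain ⟨v, hv, hmax⟩ := h.base_max f
    have hneg : ∀ i, i ≠ 2 → b v i 2 = 0 → f (latticePoint (b v i)) ≤ 0 := by
      intro i hi hi2
      obtain ⟨t, ht, hm⟩ := h.segment_mem hv hi
      have := hmax _ hm (by simp [latticePoint, hi2, h.base v hv])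
      rw [map_add, map_smul, smul_eq_mul] at this
      by_contra! h0
      nlinarith
    push_cast at hQm hRm
    rcases (hneg 0 (by decide) (h.dir_zero v hv)).lt_or_eq with h0 | h0
    · exact h.refines_of_dir_neg hv (Or.inl ⟨rfl, rfl⟩) hk hmax h0 hQ hR hQP hRP hQR hQm hRm
    rcases (hneg 1 (by decide) (h.dir_one v hv)).lt_or_eq with h1 | h1
    · exact h.refines_of_dir_neg hv (Or.inr ⟨rfl, rfl⟩) hk hmax h1 hQ hR hQP hRP hQR hQm hRm
    -- If `f` vanished along both base directions, it would vanish on the whole horizontal plane.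
    exfalso
    apply hfz
    have := congrArg f (sum_dualForm_smul (h.det v hv) z)
    rw [Fin.sum_univ_three, h.dualForm_two hv, hz, zero_smul, add_zero, map_add, map_smul,
      map_smul, h0, h1] at this
    simpa using this.symm

theorem exists_unimodular (h : PrismData P N V b) {y : Fin 3 → ℝ} (hy : y ∈ P) :
    ∃ c : Fin 4 → Fin 3 → ℤ, (∀ i, latticePoint (c i) ∈ P) ∧ IsUnit (tetraDet c) ∧
      y ∈ tetra c := by
  obtain ⟨k, hk, hky, hky'⟩ : ∃ k : ℕ, k < N ∧ (k : ℝ) ≤ y 2 ∧ y 2 ≤ (k + 1 : ℕ) := by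
    obtain ⟨h0, h1⟩ := h.height y hy
    rcases h1.lt_or_eq with h1 | h1
    · refine ⟨⌊y 2⌋₊, (Nat.floor_lt h0).2 h1, Nat.floor_le h0, ?_⟩
      push_cast
      exact (Nat.lt_floor_add_one _).le
    · have := h.pos
      refine ⟨N - 1, by omega, ?_, ?_⟩
      · rw [h1]; exact_mod_cast Nat.sub_le N 1
      · rw [h1, Nat.sub_add_cancel this]
  have hconv := h.mem_convexHull hk.le hk hy hky hky'
  obtain ⟨v, hv, -⟩ := h.base_max 0
  obtain ⟨mp, mp2⟩ := h.latticePoint_vertical_mem hv hk.le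
  obtain ⟨mq, mq2⟩ := h.latticePoint_vertical_mem hv (k := k + 1) hk
  have m0 : latticePoint (v + k • b v 2 + b v 0) ∈ P := by
    rw [latticePoint_add, latticePoint_add, latticePoint_nsmul]
    exact h.side_edge_mem hv (Or.inr ⟨rfl, rfl⟩) hk
  have m1 : latticePoint (v + k • b v 2 + b v 1) ∈ P := by
    rw [latticePoint_add, latticePoint_add, latticePoint_nsmul]
    exact h.side_edge_mem hv (Or.inl ⟨rfl, rfl⟩) hk
  -- The initial tetrahedron, spanned by the basis at `v` moved up to height `k`, has determinant
  -- `(b v).det`.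
  obtain ⟨c, hc, hd, hyc⟩ := exists_tetra_of_mem_convexHull
    (c₀ := ![v + k • b v 2, v + k • b v 2 + b v 0, v + k • b v 2 + b v 1, v + (k + 1) • b v 2])
    (by
      intro i
      fin_cases i
      · exact ⟨mp, Or.inl mp2⟩
      · exact ⟨m0, Or.inl (by
          change (v + k • b v 2) 2 + b v 0 2 = k
          rw [mp2, h.dir_zero v hv, add_zero])⟩
      · exact ⟨m1, Or.inl (by
          change (v + k • b v 2) 2 + b v 1 2 = k
          rw [mp2, h.dir_one v hv, add_zero])⟩
      · exact ⟨mq, Or.inr mq2⟩)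
    (by
      have h1 : tetraDet ![v + k • b v 2, v + k • b v 2 + b v 0, v + k • b v 2 + b v 1,
          v + (k + 1) • b v 2] = (b v).det := by
        rw [tetraDet]
        congr 1
        ext i j
        fin_cases i
        · simp
        · simp
        · simp [add_mul]
      rw [h1]
      exact (h.det v hv).ne_zero)
    hconv
  exact (h.slabRefines hk).exists_unimodular (fun i => (hc i).1)
    (fun i => by have := (hc i).2; push_cast at this; exact this) hd hyc

end PrismData

/-! ### Edge cones at the vertices of a lattice polytope. -/

theorem exists_primitive {d : ℕ} {g : Fin d → ℤ} (hg : g ≠ 0) :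
    ∃ (m : ℤ) (u : Fin d → ℤ), 0 < m ∧ Finset.univ.gcd u = 1 ∧ g = m • u := by
  obtain ⟨i, hi⟩ := Function.ne_iff.1 hg
  obtain ⟨u, hu, hu1⟩ := Finset.extract_gcd g (s := Finset.univ) ⟨i, Finset.mem_univ i⟩
  refine ⟨Finset.univ.gcd g, u, ?_, hu1, funext fun j => by simpa using hu j (Finset.mem_univ j)⟩
  have h1 : Finset.univ.gcd g ≠ 0 := fun h0 =>
    hi (Finset.gcd_eq_zero_iff.1 h0 i (Finset.mem_univ i))
  have h2 : 0 ≤ Finset.univ.gcd g := Int.nonneg_of_normalize_eq_self Finset.normalize_gcd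
  exact lt_of_le_of_ne h2 h1.symm

/-- The cone with apex `v` generated by finitely many integer vectors. -/
def latticeCone {d : ℕ} (v : Fin d → ℝ) (T : Finset (Fin d → ℤ)) : Set (Fin d → ℝ) :=
  {x | ∃ c : (Fin d → ℤ) → ℝ, (∀ g, 0 ≤ c g) ∧ x = v + ∑ g ∈ T, c g • latticePoint g}

theorem convex_latticeCone {d : ℕ} (v : Fin d → ℝ) (T : Finset (Fin d → ℤ)) :
    Convex ℝ (latticeCone v T) := by
  rintro _ ⟨c, hc, rfl⟩ _ ⟨c', hc', rfl⟩ α β hα hβ hαβ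
  refine ⟨fun g => α * c g + β * c' g, fun g =>
    add_nonneg (mul_nonneg hα (hc g)) (mul_nonneg hβ (hc' g)), ?_⟩
  simp only [add_smul, mul_smul, Finset.sum_add_distrib, ← Finset.smul_sum, smul_add]
  have : v = α • v + β • v := by rw [← add_smul, hαβ, one_smul]
  nth_rewrite 3 [this]
  abel

theorem add_smul_mem_latticeCone {d : ℕ} (v : Fin d → ℝ) {T : Finset (Fin d → ℤ)} {g : Fin d → ℤ}
    (hg : g ∈ T) {t : ℝ} (ht : 0 ≤ t) : v + t • latticePoint g ∈ latticeCone v T := by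
  classical
  refine ⟨fun h => if h = g then t else 0, fun h => ?_, ?_⟩
  · dsimp only; split_ifs <;> simp [ht]
  · simp [ite_smul, hg]

theorem exists_form_lt_of_mem_extremePoints {d : ℕ} {P : Set (Fin d → ℝ)}
    {V : Set (Fin d → ℤ)} (hV : V.Finite) (hP : P = convexHull ℝ (latticePoint '' V))
    {v : Fin d → ℝ} (hv : v ∈ Set.extremePoints ℝ P) :
    ∃ f : (Fin d → ℝ) →L[ℝ] ℝ, ∀ w ∈ V, latticePoint w ≠ v → f (latticePoint w) < f v := by
  have hconv : Convex ℝ P := hP ▸ convex_convexHull ℝ _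
  have h1 := (hconv.mem_extremePoints_iff_mem_sdiff_convexHull_sdiff.1 hv).2
  have h2 : v ∉ convexHull ℝ (latticePoint '' V \ {v}) := fun h =>
    h1 (convexHull_mono (Set.sdiff_subset_sdiff_left (hP ▸ subset_convexHull ℝ _)) h)
  obtain ⟨f, s, hs, hsv⟩ := geometric_hahn_banach_closed_point (convex_convexHull ℝ _)
    (((hV.image latticePoint).sdiff (t := {v})).isCompact_convexHull ℝ).isClosed h2
  exact ⟨f, fun w hw hwv =>
    (hs _ (subset_convexHull ℝ _ ⟨⟨w, hw, rfl⟩, hwv⟩)).trans hsv⟩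

/-- A lattice polytope is contained in the cone generated by the edges at a vertex. -/
theorem subset_latticeCone_primitiveEdgeDirections {d : ℕ} {P : Set (Fin d → ℝ)}
    (hP : IsLatticePolytope P) {v : Fin d → ℝ} (hv : v ∈ Set.extremePoints ℝ P) :
    ∃ T : Finset (Fin d → ℤ), (T : Set (Fin d → ℤ)) ⊆ primitiveEdgeDirections P v ∧
      P ⊆ latticeCone v T := by
  classical
  obtain ⟨V, hV, -, hPV⟩ := hP
  have hconv : Convex ℝ P := hPV ▸ convex_convexHull ℝ _
  have hVP : ∀ w ∈ V, latticePoint w ∈ P := fun w hw => by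
    rw [hPV]; exact subset_convexHull ℝ _ ⟨w, hw, rfl⟩
  have hvV : v ∈ latticePoint '' V := by
    rw [hPV] at hv
    exact extremePoints_convexHull_subset hv
  obtain ⟨v₀, hv₀, rfl⟩ := hvV
  obtain ⟨f, hf⟩ := exists_form_lt_of_mem_extremePoints hV hPV hv
  -- the primitive directions of the points of `V` generate the cone
  have hprim : ∀ w : Fin d → ℤ, ∃ u : Fin d → ℤ, w ∈ V → w ≠ v₀ →
      Finset.univ.gcd u = 1 ∧ ∃ t : ℝ, 0 < t ∧ latticePoint w = latticePoint v₀ +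
        t • latticePoint u := by
    intro w
    by_cases hw : w = v₀
    · exact ⟨0, fun _ h => absurd hw h⟩
    · obtain ⟨m, u, hm, hu, hmu⟩ := exists_primitive (sub_ne_zero.2 hw)
      refine ⟨u, fun _ _ => ⟨hu, m, by exact_mod_cast hm, ?_⟩⟩
      rw [← latticePoint_zsmul, ← hmu, latticePoint_sub]
      abel
  choose u hu using hprim
  let good : Finset (Fin d → ℤ) → Prop := fun T =>
    (∀ g ∈ T, Finset.univ.gcd g = 1 ∧ f (latticePoint g) < 0 ∧
      ∃ t : ℝ, 0 < t ∧ latticePoint v₀ + t • latticePoint g ∈ P) ∧ P ⊆ latticeCone (latticePoint v₀) T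
  -- A generating set of least cardinality is chosen, so that each of its vectors spans an edge of
  -- the cone.
  have hex : ∃ n : ℕ, ∃ T, good T ∧ T.card = n := by
    refine ⟨_, (hV.toFinset.erase v₀).image u, ⟨?_, ?_⟩, rfl⟩
    · intro g hg
      obtain ⟨w, hw, rfl⟩ := Finset.mem_image.1 hg
      rw [Finset.mem_erase, Set.Finite.mem_toFinset] at hw
      obtain ⟨h1, t, ht, hwt⟩ := hu w hw.2 hw.1
      refine ⟨h1, ?_, t, ht, hwt ▸ hVP w hw.2⟩
      have h2 := hf w hw.2 (fun h => hw.1 (latticePoint_injective h))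
      rw [hwt, map_add, map_smul, smul_eq_mul] at h2
      by_contra! h3
      nlinarith
    · nth_rewrite 1 [hPV]
      refine convexHull_min ?_ (convex_latticeCone _ _)
      rintro _ ⟨w, hw, rfl⟩
      by_cases hwv : w = v₀
      · subst hwv
        exact ⟨0, fun g => le_rfl, by simp⟩
      · obtain ⟨h1, t, ht, hwt⟩ := hu w hw hwv
        rw [hwt]
        exact add_smul_mem_latticeCone _ (Finset.mem_image_of_mem u (by simp [hw, hwv])) ht.le
  obtain ⟨T, ⟨hT, hPT⟩, hcard⟩ := Nat.find_spec hex
  refine ⟨T, fun g hg => ?_, hPT⟩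
  obtain ⟨hg1, hgf, t, ht, htP⟩ := hT g hg
  -- a supporting form vanishing on `g` only
  have hdisj : Disjoint (convexHull ℝ (latticePoint '' (T.erase g : Set (Fin d → ℤ))))
      (Submodule.span ℝ {latticePoint g} : Set (Fin d → ℝ)) := by
    rw [Set.disjoint_left]
    intro z hz hzg
    obtain ⟨a, rfl⟩ := Submodule.mem_span_singleton.1 hzg
    have hneg : f (a • latticePoint g) < 0 := by
      have : convexHull ℝ (latticePoint '' (T.erase g : Set (Fin d → ℤ))) ⊆ {z | f z < 0} := by
        refine convexHull_min ?_ (convex_halfSpace_lt f.toLinearMap.isLinear 0)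
        rintro _ ⟨h, hh, rfl⟩
        exact (hT h (Finset.mem_of_mem_erase hh)).2.1
      exact this hz
    have ha : 0 < a := by
      rw [map_smul, smul_eq_mul] at hneg
      by_contra! h
      nlinarith
    -- As `a > 0`, this makes `g` redundant, against minimality.
    have hcone : a • latticePoint g ∈ latticeCone 0 (T.erase g) := by
      refine convexHull_min ?_ (convex_latticeCone _ _) hz
      rintro _ ⟨h, hh, rfl⟩
      have := add_smul_mem_latticeCone 0 hh zero_le_one
      simpa using this
    obtain ⟨c, hc, hce⟩ := hcone
    rw [zero_add] at hce
    have hge : latticePoint g = ∑ h ∈ T.erase g, (a⁻¹ * c h) • latticePoint h := by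
      simp only [mul_smul]
      rw [← Finset.smul_sum, ← hce, smul_smul, inv_mul_cancel₀ ha.ne', one_smul]
    refine Nat.find_min hex (m := (T.erase g).card) ?_ ⟨T.erase g, ⟨?_, ?_⟩, rfl⟩
    · rw [← hcard]
      exact Finset.card_erase_lt_of_mem hg
    · exact fun h hh => hT h (Finset.mem_of_mem_erase hh)
    · intro x hx
      obtain ⟨e, he, rfl⟩ := hPT hx
      refine ⟨fun h => e h + e g * (a⁻¹ * c h), fun h => ?_, ?_⟩
      · have := hc h
        have := he h
        have := he g
        positivity
      · rw [← Finset.add_sum_erase T _ hg, hge]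
        simp only [add_smul, Finset.sum_add_distrib, mul_smul, Finset.smul_sum]
        congr 1
        rw [add_comm]
  obtain ⟨l, s, s', hs, hss, hs'⟩ := geometric_hahn_banach_compact_closed
    (convex_convexHull ℝ _)
    ((((T.erase g).finite_toSet).image latticePoint).isCompact_convexHull ℝ)
    (Submodule.span ℝ {latticePoint g}).convex
    (Submodule.closed_of_finiteDimensional _) hdisj
  have hlg : l (latticePoint g) = 0 := by
    by_contra hne
    have := hs' _ (Submodule.mem_span_singleton.2 ⟨s' / l (latticePoint g), rfl⟩)
    rw [map_smul, smul_eq_mul, div_mul_cancel₀ _ hne] at this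
    exact lt_irrefl _ this
  have hs0 : s' < 0 := by
    have := hs' 0 (Submodule.zero_mem _)
    simpa using this
  have hlneg : ∀ h ∈ T.erase g, l (latticePoint h) < 0 := fun h hh =>
    (hs _ (subset_convexHull ℝ _ ⟨h, hh, rfl⟩)).trans (hss.trans hs0)
  have hdec : ∀ x ∈ P, l x ≤ l (latticePoint v₀) ∧ (l x = l (latticePoint v₀) →
      ∃ c : ℝ, x = latticePoint v₀ + c • latticePoint g) := by
    intro x hx
    obtain ⟨c, hc, rfl⟩ := hPT hx
    rw [← Finset.add_sum_erase T _ hg]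
    have h1 : ∀ h ∈ T.erase g, c h * l (latticePoint h) ≤ 0 := fun h hh =>
      mul_nonpos_of_nonneg_of_nonpos (hc h) (hlneg h hh).le
    have h2 : l (latticePoint v₀ + (c g • latticePoint g + ∑ h ∈ T.erase g, c h • latticePoint h)) =
        l (latticePoint v₀) + ∑ h ∈ T.erase g, c h * l (latticePoint h) := by
      simp [hlg]
    rw [h2]
    refine ⟨by linarith [Finset.sum_nonpos h1], fun heq => ⟨c g, ?_⟩⟩
    have h3 : ∑ h ∈ T.erase g, c h * l (latticePoint h) = 0 := by linarith
    rw [Finset.sum_eq_zero_iff_of_nonpos h1] at h3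
    rw [Finset.sum_eq_zero (s := T.erase g) fun h hh => ?_, add_zero]
    rw [(mul_eq_zero.1 (h3 h hh)).resolve_right (hlneg h hh).ne, zero_smul]
  have hlt : l (latticePoint v₀ + t • latticePoint g) = l (latticePoint v₀) := by simp [hlg]
  have hv₀P : latticePoint v₀ ∈ P := hv.1
  set E : Set (Fin d → ℝ) := {x ∈ P | ∀ y ∈ P, l y ≤ l x} with hE
  have hvE : latticePoint v₀ ∈ E := ⟨hv₀P, fun y hy => (hdec y hy).1⟩
  have htE : latticePoint v₀ + t • latticePoint g ∈ E :=
    ⟨htP, fun y hy => by rw [hlt]; exact (hdec y hy).1⟩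
  refine ⟨hg1, E, ⟨⟨_, hvE⟩, fun _ => ⟨l, rfl⟩, ?_⟩, hvE, t, ht, htE⟩
  have hspan : vectorSpan ℝ E = Submodule.span ℝ {latticePoint g} := by
    apply le_antisymm
    · rw [vectorSpan_def, Submodule.span_le]
      rintro _ ⟨x, hx, y, hy, rfl⟩
      obtain ⟨a, ha⟩ := (hdec x hx.1).2 (le_antisymm (hdec x hx.1).1 (hx.2 _ hv₀P))
      obtain ⟨b, hb⟩ := (hdec y hy.1).2 (le_antisymm (hdec y hy.1).1 (hy.2 _ hv₀P))
      refine Submodule.mem_span_singleton.2 ⟨a - b, ?_⟩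
      simp only [ha, hb, vsub_eq_sub]
      module
    · rw [Submodule.span_singleton_le_iff_mem]
      have := vsub_mem_vectorSpan ℝ htE hvE
      rw [vsub_eq_sub, add_sub_cancel_left] at this
      exact (Submodule.smul_mem_iff _ ht.ne').1 this
  rw [polytopeDim, hspan]
  refine finrank_span_singleton fun h0 => ?_
  rw [h0] at hgf
  simp at hgf

/-- `P` lies in the cone with apex `v` generated by the rows of the unimodular matrix `M`, and
contains a segment from `v` in the direction of each row. -/
structure IsVertexCone (P : Set (Fin 3 → ℝ)) (v : Fin 3 → ℝ) (M : Matrix (Fin 3) (Fin 3) ℤ) :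
    Prop where
  det : IsUnit M.det
  dir : ∀ i, ∃ t : ℝ, 0 < t ∧ v + t • latticePoint (M i) ∈ P
  cone : ∀ x ∈ P, ∃ c : Fin 3 → ℝ, (∀ i, 0 ≤ c i) ∧ x = v + ∑ i, c i • latticePoint (M i)

theorem IsSmoothPolytope.exists_isVertexCone {P : Set (Fin 3 → ℝ)} (hP : IsLatticePolytope P)
    (hs : IsSmoothPolytope P) {v : Fin 3 → ℝ} (hv : v ∈ Set.extremePoints ℝ P) :
    ∃ M, IsVertexCone P v M := by
  obtain ⟨hli, hspan⟩ := hs.2 v hv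
  set U := primitiveEdgeDirections P v with hU
  let B : Module.Basis U ℤ (Fin 3 → ℤ) := Module.Basis.mk hli (by
    rw [← hspan]
    apply Submodule.span_mono
    intro g hg
    exact ⟨⟨g, hg⟩, rfl⟩)
  let e : Fin 3 ≃ U := (Pi.basisFun ℤ (Fin 3)).indexEquiv B
  have hB : ∀ i, (B.reindex e.symm) i = (e i : Fin 3 → ℤ) := fun i => by simp [B]
  obtain ⟨T, hTU, hPT⟩ := subset_latticeCone_primitiveEdgeDirections hP hv
  refine ⟨Matrix.of fun i => (e i : Fin 3 → ℤ), ?_, ?_, ?_⟩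
  · have := (Pi.basisFun ℤ (Fin 3)).isUnit_det (B.reindex e.symm)
    rw [Pi.basisFun_det, show ⇑(B.reindex e.symm) = fun i => (e i : Fin 3 → ℤ) from funext hB]
      at this
    exact this
  · intro i
    obtain ⟨-, E, hE, hvE, t, ht, htE⟩ := (e i).2
    exact ⟨t, ht, hE.2.1.subset htE⟩
  · intro x hx
    obtain ⟨c, hc, rfl⟩ := hPT hx
    classical
    refine ⟨fun i => if (e i : Fin 3 → ℤ) ∈ T then c (e i) else 0, fun i => ?_, ?_⟩
    · dsimp only; split_ifs <;> simp [hc]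
    · congr 1
      simp only [ite_smul, zero_smul]
      rw [← Finset.sum_filter]
      symm
      refine Finset.sum_bij (fun i _ => (e i : Fin 3 → ℤ)) ?_ ?_ ?_ ?_
      · intro i hi
        exact (Finset.mem_filter.1 hi).2
      · intro i _ j _ h
        exact e.injective (Subtype.ext h)
      · intro g hg
        refine ⟨e.symm ⟨g, hTU hg⟩, ?_, ?_⟩
        · simpa using hg
        · simp
      · intro i _
        rfl

namespace IsVertexCone

variable {P : Set (Fin 3 → ℝ)} {v : Fin 3 → ℝ} {M : Matrix (Fin 3) (Fin 3) ℤ}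

theorem permute (h : IsVertexCone P v M) (σ : Equiv.Perm (Fin 3)) :
    IsVertexCone P v (M.submatrix σ id) := by
  refine ⟨?_, fun i => h.dir (σ i), fun x hx => ?_⟩
  · rw [Matrix.det_permute]
    exact ((Equiv.Perm.sign σ).isUnit.map (Int.castRingHom ℤ)).mul h.det
  · obtain ⟨c, hc, rfl⟩ := h.cone x hx
    refine ⟨c ∘ σ, fun i => hc _, ?_⟩
    rw [← Equiv.sum_comp σ]
    rfl

theorem dualForm_nonneg (h : IsVertexCone P v M) {x : Fin 3 → ℝ} (hx : x ∈ P) (i : Fin 3) :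
    0 ≤ dualForm M i (x - v) := by
  obtain ⟨c, hc, rfl⟩ := h.cone x hx
  rw [add_sub_cancel_left, map_sum]
  refine Finset.sum_nonneg fun j _ => ?_
  rw [map_smul, dualForm_row h.det]
  split_ifs <;> simp [hc]

/-- The last point of `P` on the ray from a vertex along an edge is again a vertex. -/
theorem exists_mem_extremePoints (h : IsVertexCone P v M) (hP : IsCompact P) (hvP : v ∈ P)
    (i : Fin 3) : ∃ t : ℝ, 0 < t ∧ v + t • latticePoint (M i) ∈ Set.extremePoints ℝ P := by
  have hcont : ∀ j, Continuous fun x => dualForm M j (x - v) := fun j =>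
    (dualForm M j).continuous_of_finiteDimensional.comp (continuous_id.sub continuous_const)
  -- The part of `P` on the ray. The coordinates set to zero are nonnegative on `P`, so `E` is a
  -- face and its farthest point is extreme in `P`.
  set E : Set (Fin 3 → ℝ) := P ∩ ⋂ j, ⋂ (_ : j ≠ i), {x | dualForm M j (x - v) = 0} with hE
  have hEmem : ∀ x, x ∈ E ↔ x ∈ P ∧ ∀ j, j ≠ i → dualForm M j (x - v) = 0 := fun x => by
    simp [hE]
  have hEc : IsCompact E := by
    refine hP.inter_right (isClosed_iInter fun j => isClosed_iInter fun _ => ?_)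
    exact isClosed_eq (hcont j) continuous_const
  have hray : ∀ x ∈ E, x = v + dualForm M i (x - v) • latticePoint (M i) := by
    intro x hx
    rw [hEmem] at hx
    have h1 := sum_dualForm_smul h.det (x - v)
    rw [Finset.sum_eq_single i (fun j _ hj => by rw [hx.2 j hj, zero_smul]) (by simp)] at h1
    rw [h1]
    abel
  obtain ⟨x, hxE, hmax⟩ := hEc.exists_isMaxOn ⟨v, (hEmem v).2 ⟨hvP, by simp⟩⟩ (hcont i).continuousOn
  have hxP := ((hEmem x).1 hxE).1
  have hx0 := ((hEmem x).1 hxE).2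
  obtain ⟨t, ht, htP⟩ := h.dir i
  have htE : v + t • latticePoint (M i) ∈ E := by
    refine (hEmem _).2 ⟨htP, fun j hj => ?_⟩
    rw [add_sub_cancel_left, map_smul, dualForm_row h.det, if_neg hj.symm, smul_zero]
  have htx := hmax htE
  simp only [Set.mem_ofPred_eq, add_sub_cancel_left, map_smul, dualForm_row h.det, if_true,
    smul_eq_mul, mul_one] at htx
  refine ⟨dualForm M i (x - v), lt_of_lt_of_le ht htx, ?_⟩
  rw [← hray x hxE, mem_extremePoints]
  refine ⟨hxP, fun y hy z hz hyz => ?_⟩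
  obtain ⟨a, b, ha, hb, hab, rfl⟩ := hyz
  have hcomb : ∀ j, dualForm M j (a • y + b • z - v) =
      a * dualForm M j (y - v) + b * dualForm M j (z - v) := by
    intro j
    rw [← smul_eq_mul, ← smul_eq_mul, ← map_smul, ← map_smul, ← map_add]
    congr 1
    have : v = a • v + b • v := by rw [← add_smul, hab, one_smul]
    nth_rewrite 1 [this]
    module
  have hyE : y ∈ E := by
    refine (hEmem y).2 ⟨hy, fun j hj => ?_⟩
    have h1 := hx0 j hj
    rw [hcomb] at h1
    nlinarith [h.dualForm_nonneg hy j, h.dualForm_nonneg hz j,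
      mul_nonneg hb.le (h.dualForm_nonneg hz j)]
  have hzE : z ∈ E := by
    refine (hEmem z).2 ⟨hz, fun j hj => ?_⟩
    have h1 := hx0 j hj
    rw [hcomb] at h1
    nlinarith [h.dualForm_nonneg hy j, h.dualForm_nonneg hz j,
      mul_nonneg ha.le (h.dualForm_nonneg hy j)]
  have h1 : dualForm M i (y - v) ≤ dualForm M i (a • y + b • z - v) := hmax hyE
  have h2 : dualForm M i (z - v) ≤ dualForm M i (a • y + b • z - v) := hmax hzE
  have h3 := hcomb i
  have h4 : dualForm M i (y - v) = dualForm M i (a • y + b • z - v) := by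
    refine le_antisymm h1 ?_
    by_contra! h5
    nlinarith
  have h5 : dualForm M i (z - v) = dualForm M i (a • y + b • z - v) := by
    refine le_antisymm h2 ?_
    by_contra! h5
    nlinarith
  have h6 := hray _ hxE
  constructor
  · rw [h6, ← h4]; exact hray y hyE
  · rw [h6, ← h5]; exact hray z hzE

end IsVertexCone

/-! ### The two parallel facets. -/

theorem apply_eq_of_mem_vectorSpan {E : Type*} [AddCommGroup E] [Module ℝ E] {S : Set E}
    {l : E →ₗ[ℝ] ℝ} (h : ∀ x ∈ S, ∀ y ∈ S, l x = l y) : vectorSpan ℝ S ≤ LinearMap.ker l := by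
  rw [vectorSpan_def, Submodule.span_le]
  rintro _ ⟨x, hx, y, hy, rfl⟩
  simp [h x hx y hy]

/-- A prismatoid lies between two parallel planes, each containing a facet, which together contain
all its vertices. -/
theorem IsPrismatoid.exists_form {P : Set (Fin 3 → ℝ)} (hdim : polytopeDim P = 3)
    (hP : IsPrismatoid P) : ∃ (l : (Fin 3 → ℝ) →L[ℝ] ℝ) (α β : ℝ),
      (∀ x ∈ P, α ≤ l x ∧ l x ≤ β) ∧ {x ∈ P | l x = α}.Nonempty ∧
      polytopeDim {x ∈ P | l x = α} = 2 ∧ ∀ v ∈ Set.extremePoints ℝ P, l v = α ∨ l v = β := by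
  obtain ⟨F, G, ⟨k, hk, hFne, hFe, hFd⟩, ⟨k', hk', hGne, hGe, hGd⟩, hFG, hpar, hext⟩ := hP
  obtain rfl : k = 2 := by omega
  obtain rfl : k' = 2 := by omega
  obtain ⟨l, hl⟩ := hFe hFne
  obtain ⟨m, hm⟩ := hGe hGne
  have hdir : vectorSpan ℝ F = vectorSpan ℝ G := by
    rw [← direction_affineSpan, ← direction_affineSpan]
    exact hpar.direction_eq
  have hlF : ∀ x ∈ F, ∀ y ∈ F, l x = l y := by
    intro x hx y hy
    rw [hl] at hx hy
    exact le_antisymm (hy.2 x hx.1) (hx.2 y hy.1)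
  have hmG : ∀ x ∈ G, ∀ y ∈ G, m x = m y := by
    intro x hx y hy
    rw [hm] at hx hy
    exact le_antisymm (hy.2 x hx.1) (hx.2 y hy.1)
  have hkl := apply_eq_of_mem_vectorSpan (l := l.toLinearMap) hlF
  have hkm := apply_eq_of_mem_vectorSpan (l := m.toLinearMap) hmG
  have hFP : F ≠ P := by
    rintro rfl
    rw [hdim] at hFd
    omega
  have hl0 : ∃ z, l z ≠ 0 := by
    by_contra! h
    apply hFP
    rw [hl]
    ext x
    simp [h]
  obtain ⟨z, hz⟩ := hl0
  -- `F` is two-dimensional, so its direction fills the kernel of `l`; as `G` has the same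
  -- direction, `m` is a multiple of `l`.
  have hker : vectorSpan ℝ F = LinearMap.ker l.toLinearMap := by
    refine Submodule.eq_of_le_of_finrank_le hkl ?_
    have h1 := LinearMap.finrank_range_add_finrank_ker l.toLinearMap
    have h2 : Module.finrank ℝ (LinearMap.range l.toLinearMap) = 1 := by
      rw [LinearMap.range_eq_top.2 (LinearMap.surjective (f := l.toLinearMap) (fun h => hz (by
        have := congrArg (fun f : (Fin 3 → ℝ) →ₗ[ℝ] ℝ => f z) h
        simpa using this))), finrank_top, Module.finrank_self]
    rw [h2, Module.finrank_fin_fun] at h1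
    rw [polytopeDim] at hFd
    omega
  obtain ⟨c, hc⟩ : ∃ c : ℝ, ∀ x, m x = c * l x := by
    refine ⟨m z / l z, fun x => ?_⟩
    have h1 : x - (l x / l z) • z ∈ LinearMap.ker l.toLinearMap := by
      simp [hz]
    rw [← hker, hdir] at h1
    have h2 := hkm h1
    have h3 : m x - l x / l z * m z = 0 := by simpa using h2
    rw [sub_eq_zero.1 h3]
    ring
  have hc0 : c < 0 := by
    by_contra! hc0
    apply hFG
    rcases hc0.eq_or_lt with rfl | hc0
    · exfalso
      have : G = P := by
        rw [hm]
        ext x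
        simp [hc]
      rw [this, hdim] at hGd
      omega
    · rw [hl, hm]
      ext x
      simp only [hc, Set.mem_ofPred_eq]
      refine and_congr_right fun _ => forall_congr' fun y => forall_congr' fun _ => ?_
      exact (mul_le_mul_iff_right₀ hc0).symm
  obtain ⟨a, ha⟩ := hFne
  obtain ⟨b, hb⟩ := hGne
  have ha' := ha
  have hb' := hb
  rw [hl] at ha'
  rw [hm] at hb'
  have hset : {x ∈ P | (-l) x = -l a} = F := by
    ext x
    rw [hl]
    simp only [Set.mem_ofPred_eq, neg_apply, neg_inj]
    refine and_congr_right fun hx => ⟨fun h y hy => h ▸ ha'.2 y hy, fun h => ?_⟩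
    exact le_antisymm (ha'.2 x hx) (h a ha'.1)
  -- `F` maximizes `l`; the sign change makes it the bottom facet.
  refine ⟨-l, -l a, -l b, fun x hx => ⟨?_, ?_⟩, ?_, ?_, fun v hv => ?_⟩
  · simpa using ha'.2 x hx
  · have := hb'.2 x hx
    rw [hc, hc] at this
    simp only [neg_apply, neg_le_neg_iff]
    by_contra! h
    nlinarith
  · rw [hset]; exact ⟨a, ha⟩
  · rw [hset]; exact hFd
  · rcases hext hv with h | h
    · left
      simp [hlF v h a ha]
    · right
      have := hmG v h b hb
      rw [hc, hc] at this
      simp [mul_left_cancel₀ hc0.ne this]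

/-- At a vertex of the bottom facet two of the three edges are in the facet. -/
theorem IsVertexCone.exists_reorder {P : Set (Fin 3 → ℝ)} {v : Fin 3 → ℝ}
    {M : Matrix (Fin 3) (Fin 3) ℤ} (h : IsVertexCone P v M) (hdim : polytopeDim P = 3)
    {l : (Fin 3 → ℝ) →L[ℝ] ℝ} (hl : ∀ x ∈ P, l v ≤ l x)
    (hF : polytopeDim {x ∈ P | l x = l v} = 2) :
    ∃ M', IsVertexCone P v M' ∧ l (latticePoint (M' 0)) = 0 ∧ l (latticePoint (M' 1)) = 0 ∧
      0 < l (latticePoint (M' 2)) := by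
  have hnn : ∀ i, 0 ≤ l (latticePoint (M i)) := by
    intro i
    obtain ⟨t, ht, hm⟩ := h.dir i
    have := hl _ hm
    rw [map_add, map_smul, smul_eq_mul] at this
    by_contra! h0
    nlinarith
  obtain ⟨i, hi⟩ : ∃ i, 0 < l (latticePoint (M i)) := by
    by_contra! hcon
    have : {x ∈ P | l x = l v} = P := by
      ext x
      simp only [Set.mem_ofPred_eq, and_iff_left_iff_imp]
      intro hx
      obtain ⟨c, hc, rfl⟩ := h.cone x hx
      rw [map_add, map_sum, Finset.sum_eq_zero fun j _ => ?_, add_zero]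
      rw [map_smul, le_antisymm (hcon j) (hnn j), smul_zero]
    rw [this, hdim] at hF
    omega
  -- With two rising rows the bottom face would lie on the line in the third direction and have
  -- dimension at most one.
  have hzero : ∀ j, j ≠ i → l (latticePoint (M j)) = 0 := by
    intro j hji
    by_contra hj
    have hj := lt_of_le_of_ne (hnn j) (Ne.symm hj)
    have hthird : ∀ i j : Fin 3, j ≠ i → ∃ k : Fin 3, ∀ j', j' ≠ i → j' ≠ j → j' = k := by
      decide
    obtain ⟨k, hk⟩ := hthird i j hji
    have hsub : vectorSpan ℝ {x ∈ P | l x = l v} ≤ Submodule.span ℝ {latticePoint (M k)} := by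
      have hrep : ∀ x ∈ P, l x = l v → ∃ s : ℝ, x = v + s • latticePoint (M k) := by
        intro x hx hxv
        obtain ⟨c, hc, rfl⟩ := h.cone x hx
        rw [map_add, add_eq_left, map_sum] at hxv
        have hnn' : ∀ j' ∈ Finset.univ, 0 ≤ l (c j' • latticePoint (M j')) := fun j' _ => by
          rw [map_smul]; exact mul_nonneg (hc j') (hnn j')
        rw [Finset.sum_eq_zero_iff_of_nonneg hnn'] at hxv
        refine ⟨c k, ?_⟩
        rw [Finset.sum_eq_single k ?_ (by simp)]
        intro j' _ hj'
        have hpos : 0 < l (latticePoint (M j')) := by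
          by_cases h1 : j' = i
          · rwa [h1]
          · by_cases h2 : j' = j
            · rwa [h2]
            · exact absurd (hk j' h1 h2) hj'
        have := hxv j' (Finset.mem_univ _)
        rw [map_smul, smul_eq_mul] at this
        rw [(mul_eq_zero.1 this).resolve_right hpos.ne', zero_smul]
      rw [vectorSpan_def, Submodule.span_le]
      rintro _ ⟨x, hx, y, hy, rfl⟩
      obtain ⟨a, ha⟩ := hrep x hx.1 hx.2
      obtain ⟨b, hb⟩ := hrep y hy.1 hy.2
      refine Submodule.mem_span_singleton.2 ⟨a - b, ?_⟩
      simp only [ha, hb, vsub_eq_sub]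
      module
    have h1 := Submodule.finrank_mono hsub
    have h2 := finrank_span_le_card (R := ℝ) ({latticePoint (M k)} : Set (Fin 3 → ℝ))
    rw [polytopeDim] at hF
    rw [hF] at h1
    simp at h2
    omega
  refine ⟨_, h.permute (Equiv.swap 2 i), ?_, ?_, ?_⟩
  · refine hzero (Equiv.swap 2 i 0) fun h0 => ?_
    have := (Equiv.swap 2 i).injective (h0.trans (Equiv.swap_apply_left 2 i).symm)
    exact absurd this (by decide)
  · refine hzero (Equiv.swap 2 i 1) fun h0 => ?_
    have := (Equiv.swap 2 i).injective (h0.trans (Equiv.swap_apply_left 2 i).symm)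
    exact absurd this (by decide)
  · change 0 < l (latticePoint (M (Equiv.swap 2 i 2)))
    rw [Equiv.swap_apply_left]
    exact hi

/-! ### The unimodular change of coordinates. -/

/-- The linear map sending the standard basis to the rows of an integer matrix. -/
noncomputable def rowMap (A : Matrix (Fin 3) (Fin 3) ℤ) : (Fin 3 → ℝ) →ₗ[ℝ] (Fin 3 → ℝ) :=
  ∑ i, (LinearMap.proj i).smulRight (latticePoint (A i))

theorem rowMap_apply (A : Matrix (Fin 3) (Fin 3) ℤ) (y : Fin 3 → ℝ) :
    rowMap A y = ∑ i, y i • latticePoint (A i) := by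
  simp [rowMap]

theorem rowMap_latticePoint (A : Matrix (Fin 3) (Fin 3) ℤ) (g : Fin 3 → ℤ) :
    rowMap A (latticePoint g) = latticePoint (Matrix.vecMul g A) := by
  ext j
  simp [rowMap_apply, latticePoint, Matrix.vecMul, dotProduct]

theorem rowMap_dualForm {A : Matrix (Fin 3) (Fin 3) ℤ} (hA : IsUnit A.det) (x : Fin 3 → ℝ) :
    rowMap A (fun i => dualForm A i x) = x := by
  rw [rowMap_apply, sum_dualForm_smul hA]

theorem dualForm_rowMap {A : Matrix (Fin 3) (Fin 3) ℤ} (hA : IsUnit A.det) (y : Fin 3 → ℝ)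
    (i : Fin 3) : dualForm A i (rowMap A y) = y i := by
  simp [rowMap_apply, map_sum, dualForm_row hA]

theorem rowMap_injective {A : Matrix (Fin 3) (Fin 3) ℤ} (hA : IsUnit A.det) :
    Function.Injective (rowMap A) := fun y z h => funext fun i => by
  rw [← dualForm_rowMap hA y, h, dualForm_rowMap hA]

theorem IsLatticePolytope.isCompact {d : ℕ} {P : Set (Fin d → ℝ)} (hP : IsLatticePolytope P) :
    IsCompact P := by
  obtain ⟨V, hV, -, rfl⟩ := hP
  exact (hV.image _).isCompact_convexHull ℝ

theorem IsLatticePolytope.convex {d : ℕ} {P : Set (Fin d → ℝ)} (hP : IsLatticePolytope P) :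
    Convex ℝ P := by
  obtain ⟨V, -, -, rfl⟩ := hP
  exact convex_convexHull ℝ _

theorem IsLatticePolytope.exists_latticePoint {d : ℕ} {P : Set (Fin d → ℝ)}
    (hP : IsLatticePolytope P) {v : Fin d → ℝ} (hv : v ∈ Set.extremePoints ℝ P) :
    ∃ w, latticePoint w = v := by
  obtain ⟨V, -, -, rfl⟩ := hP
  obtain ⟨w, -, hw⟩ := extremePoints_convexHull_subset hv
  exact ⟨w, hw⟩

theorem exists_extremePoint_face_max {d : ℕ} {P : Set (Fin d → ℝ)} (hP : IsCompact P)
    {l : (Fin d → ℝ) →L[ℝ] ℝ} {α : ℝ} (hl : ∀ x ∈ P, α ≤ l x) (hne : {x ∈ P | l x = α}.Nonempty)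
    (f : (Fin d → ℝ) →L[ℝ] ℝ) :
    ∃ v ∈ Set.extremePoints ℝ P, l v = α ∧ ∀ x ∈ P, l x = α → f x ≤ f v := by
  set F := {x ∈ P | l x = α} with hF
  obtain ⟨a, ha⟩ := hne
  have hFe : IsExposed ℝ P F := fun _ => ⟨-l, by
    ext x
    simp only [hF, Set.mem_ofPred_eq, neg_apply, neg_le_neg_iff]
    refine and_congr_right fun hx => ⟨fun h y hy => h ▸ hl y hy, fun h => ?_⟩
    exact le_antisymm ((h a ha.1).trans ha.2.le) (hl x hx)⟩
  have hFc : IsCompact F := hFe.isCompact hP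
  set E := {x ∈ F | ∀ y ∈ F, f y ≤ f x} with hE
  have hEe : IsExposed ℝ F E := fun _ => ⟨f, rfl⟩
  obtain ⟨b, hb, hbm⟩ := hFc.exists_isMaxOn ⟨a, ha⟩ f.continuous.continuousOn
  obtain ⟨v, hv⟩ := (hEe.isCompact hFc).extremePoints_nonempty ⟨b, hb, fun y hy => hbm hy⟩
  refine ⟨v, ?_, hv.1.1.2, fun x hx hxα => hv.1.2 x ⟨hx, hxα⟩⟩
  exact hFe.isExtreme.extremePoints_subset_extremePoints
    (hEe.isExtreme.extremePoints_subset_extremePoints hv)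

/-- The end of the edge is a lattice point, and its distance in multiples of `M i` is read off by an
integral dual form, hence is an integer. -/
theorem IsVertexCone.exists_nat_mem_extremePoints {P : Set (Fin 3 → ℝ)} (hP : IsLatticePolytope P)
    {v : Fin 3 → ℤ} {M : Matrix (Fin 3) (Fin 3) ℤ} (h : IsVertexCone P (latticePoint v) M)
    (hvP : latticePoint v ∈ P) (i : Fin 3) :
    ∃ t : ℕ, 0 < t ∧ latticePoint (v + t • M i) ∈ Set.extremePoints ℝ P := by
  obtain ⟨t, ht, hm⟩ := h.exists_mem_extremePoints hP.isCompact hvP i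
  obtain ⟨w, hw⟩ := hP.exists_latticePoint hm
  have h1 : dualForm M i (latticePoint (w - v)) = t := by
    rw [latticePoint_sub, hw, add_sub_cancel_left, map_smul, dualForm_row h.det, if_pos rfl]
    simp
  rw [dualForm_latticePoint] at h1
  obtain ⟨n, hn⟩ : ∃ n : ℤ, (n : ℝ) = t := ⟨_, h1⟩
  have hn0 : 0 < n := by
    rw [← hn] at ht
    exact_mod_cast ht
  lift n to ℕ using hn0.le
  refine ⟨n, by exact_mod_cast hn0, ?_⟩
  rw [latticePoint_add, latticePoint_nsmul]
  rw [← hn] at hm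
  exact_mod_cast hm

/-- The data of a smooth prismatoid, in the coordinates given by a vertex of its bottom facet. -/
theorem exists_prismData {P : Set (Fin 3 → ℝ)} (hP : IsLatticePolytope P) (hdim : polytopeDim P = 3)
    (hsmooth : IsSmoothPolytope P) (hprism : IsPrismatoid P) :
    ∃ (v₀ : Fin 3 → ℤ) (A : Matrix (Fin 3) (Fin 3) ℤ) (N : ℕ) (V : Set (Fin 3 → ℤ))
      (b : (Fin 3 → ℤ) → Matrix (Fin 3) (Fin 3) ℤ), IsUnit A.det ∧
      PrismData {y | latticePoint v₀ + rowMap A y ∈ P} N V b := by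
  obtain ⟨l, α, β, hl, hne, hF, hext⟩ := hprism.exists_form hdim
  have hα := fun x hx => (hl x hx).1
  set W : Set (Fin 3 → ℤ) :=
    {v | latticePoint v ∈ Set.extremePoints ℝ P ∧ l (latticePoint v) = α} with hW
  have hM : ∀ v, ∃ M : Matrix (Fin 3) (Fin 3) ℤ, v ∈ W → IsVertexCone P (latticePoint v) M ∧
      l (latticePoint (M 0)) = 0 ∧ l (latticePoint (M 1)) = 0 ∧ 0 < l (latticePoint (M 2)) := by
    intro v
    by_cases hv : v ∈ W
    · obtain ⟨M, hM⟩ := hsmooth.exists_isVertexCone hP hv.1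
      obtain ⟨M', hM'⟩ := hM.exists_reorder hdim (l := l) (by rw [hv.2]; exact hα)
        (by rw [hv.2]; exact hF)
      exact ⟨M', fun _ => hM'⟩
    · exact ⟨0, fun h => absurd h hv⟩
  choose M hM using hM
  have hlform : ∀ v ∈ W, ∀ x, l x = dualForm (M v) 2 x * l (latticePoint (M v 2)) := by
    intro v hv x
    obtain ⟨hc, h0, h1, -⟩ := hM v hv
    nth_rewrite 1 [← sum_dualForm_smul hc.det x]
    rw [Fin.sum_univ_three, map_add, map_add, map_smul, map_smul, map_smul, h0, h1]
    simp
  obtain ⟨v, hv, hvα, -⟩ := exists_extremePoint_face_max hP.isCompact hα hne 0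
  obtain ⟨v₀, rfl⟩ := hP.exists_latticePoint hv
  have hv₀ : v₀ ∈ W := ⟨hv, hvα⟩
  obtain ⟨hA, hA0, hA1, hA2⟩ := hM v₀ hv₀
  set A := M v₀ with hAdef
  have hdetA := hA.det
  obtain ⟨lam, hlam⟩ : ∃ lam, lam = l (latticePoint (A 2)) := ⟨_, rfl⟩
  rw [← hlam] at hA2
  -- Expanding each rising direction in the lattice basis at the other vertex shows that each of the
  -- two values is a positive integer multiple of the other.
  have hlamv : ∀ v ∈ W, l (latticePoint (M v 2)) = lam := by
    intro v hv
    obtain ⟨-, -, -, h2⟩ := hM v hv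
    have e1 := hlform v hv (latticePoint (A 2))
    have e2 := hlform v₀ hv₀ (latticePoint (M v 2))
    rw [dualForm_latticePoint, ← hlam] at e1 e2
    generalize (∑ j, A 2 j * (M v)⁻¹ j 2 : ℤ) = n at e1
    generalize (∑ j, M v 2 j * (M v₀)⁻¹ j 2 : ℤ) = n' at e2
    have hn : (0 : ℝ) < n := by
      by_contra! h0
      nlinarith
    have hn' : (0 : ℝ) < n' := by
      by_contra! h0
      nlinarith
    have h1 : (1 : ℝ) ≤ n := by
      have : (0 : ℤ) < n := by exact_mod_cast hn
      exact_mod_cast this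
    have h1' : (1 : ℝ) ≤ n' := by
      have : (0 : ℤ) < n' := by exact_mod_cast hn'
      exact_mod_cast this
    nlinarith
  have hlrow : ∀ y, l (rowMap A y) = lam * y 2 := by
    intro y
    rw [hlform v₀ hv₀, ← hAdef, dualForm_rowMap hdetA, ← hlam, mul_comm]
  -- The rising edge ends at a vertex with `l` above `α`, hence equal to `β`; so all these edges
  -- have the same lattice length `N`.
  have htop : ∀ v ∈ W, ∃ t : ℕ, 0 < t ∧ latticePoint (v + t • M v 2) ∈ Set.extremePoints ℝ P ∧
      α + t * lam = β := by
    intro v hv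
    obtain ⟨t, ht, hm⟩ := (hM v hv).1.exists_nat_mem_extremePoints hP hv.1.1 2
    refine ⟨t, ht, hm, ?_⟩
    have h1 : l (latticePoint (v + t • M v 2)) = α + t * lam := by
      rw [latticePoint_add, latticePoint_nsmul, map_add, map_smul, hlamv v hv, hv.2, smul_eq_mul]
    rcases hext _ hm with h2 | h2
    · rw [h1] at h2
      have : (0 : ℝ) < t := by exact_mod_cast ht
      nlinarith
    · rw [← h1, h2]
  obtain ⟨N, hN, -, hNβ⟩ := htop v₀ hv₀
  set κ : (Fin 3 → ℤ) → (Fin 3 → ℤ) := fun g => v₀ + Matrix.vecMul g A with hκ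
  have hφκ : ∀ g, latticePoint v₀ + rowMap A (latticePoint g) = latticePoint (κ g) := by
    intro g
    rw [rowMap_latticePoint, ← latticePoint_add]
  have hrow : ∀ v i, Matrix.vecMul ((M v * A⁻¹) i) A = M v i := by
    intro v i
    rw [← Matrix.mul_apply_eq_vecMul, Matrix.mul_assoc, Matrix.nonsing_inv_mul A hdetA,
      Matrix.mul_one]
  have hrowR : ∀ v i, rowMap A (latticePoint ((M v * A⁻¹) i)) = latticePoint (M v i) := by
    intro v i
    rw [rowMap_latticePoint, hrow]
  have hheight : ∀ v i, lam * (((M v * A⁻¹) i 2 : ℤ) : ℝ) = l (latticePoint (M v i)) := by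
    intro v i
    rw [← hrowR, hlrow]
    rfl
  refine ⟨v₀, A, N, {g | κ g ∈ W}, fun g => M (κ g) * A⁻¹, hdetA, ?_⟩
  refine ⟨?_, ?_, hN, ?_, ?_, ?_, ?_, ?_, ?_, ?_, ?_, ?_, ?_, ?_⟩
  · have := (hP.convex.translate_preimage_right (latticePoint v₀)).linear_preimage (rowMap A)
    exact this
  · have hc : Continuous fun x : Fin 3 → ℝ => fun i => dualForm A i (x - latticePoint v₀) :=
      continuous_pi fun i => (dualForm A i).continuous_of_finiteDimensional.comp
        (continuous_id.sub continuous_const)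
    refine (hP.isCompact.image hc).isBounded.subset fun y hy => ⟨_, hy, funext fun i => ?_⟩
    change dualForm A i (latticePoint v₀ + rowMap A y - latticePoint v₀) = y i
    rw [add_sub_cancel_left, dualForm_rowMap hdetA]
  · intro y hy
    have h1 := hl _ hy
    rw [map_add, hvα, hlrow] at h1
    constructor
    · by_contra! h0
      nlinarith
    · by_contra! h0
      nlinarith
  · intro f
    let f' : (Fin 3 → ℝ) →ₗ[ℝ] ℝ := f ∘ₗ LinearMap.pi (dualForm A)
    obtain ⟨v, hv, hvα', hmax⟩ := exists_extremePoint_face_max hP.isCompact hα hne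
      f'.toContinuousLinearMap
    obtain ⟨w, rfl⟩ := hP.exists_latticePoint hv
    have hg : κ (Matrix.vecMul (w - v₀) A⁻¹) = w := by
      rw [hκ]
      simp [Matrix.vecMul_vecMul, Matrix.nonsing_inv_mul A hdetA]
    have hf' : ∀ y, f' (latticePoint v₀ + rowMap A y) = f' (latticePoint v₀) + f y := by
      intro y
      rw [map_add]
      congr 1
      change f (fun i => dualForm A i (rowMap A y)) = f y
      congr 1
      exact funext fun i => dualForm_rowMap hdetA y i
    refine ⟨Matrix.vecMul (w - v₀) A⁻¹, ?_, fun y hy hy2 => ?_⟩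
    · change κ _ ∈ W
      rw [hg]
      exact ⟨hv, hvα'⟩
    · have h1 := hmax _ hy (by rw [map_add, hvα, hlrow, hy2]; simp)
      rw [LinearMap.coe_toContinuousLinearMap', hf', ← hg, ← hφκ, hf'] at h1
      linarith
  · intro g hg
    change latticePoint v₀ + rowMap A (latticePoint g) ∈ P
    rw [hφκ]
    exact hg.1.1
  · intro g hg
    have h1 := hg.2
    rw [← hφκ, map_add, hvα, hlrow, add_eq_left] at h1
    have h2 := (mul_eq_zero.1 h1).resolve_left hA2.ne'
    simpa [latticePoint] using h2
  · intro g hg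
    have h1 := hheight (κ g) 0
    rw [(hM _ hg).2.1] at h1
    exact_mod_cast (mul_eq_zero.1 h1).resolve_left hA2.ne'
  · intro g hg
    have h1 := hheight (κ g) 1
    rw [(hM _ hg).2.2.1] at h1
    exact_mod_cast (mul_eq_zero.1 h1).resolve_left hA2.ne'
  · intro g hg
    have h1 := hheight (κ g) 2
    rw [hlamv _ hg, mul_eq_left₀ hA2.ne'] at h1
    exact_mod_cast h1
  · intro g hg
    rw [Matrix.det_mul]
    exact (hM _ hg).1.det.mul (Matrix.isUnit_nonsing_inv_det A hdetA)
  · intro g hg y hy i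
    obtain ⟨c, hc, hce⟩ := (hM _ hg).1.cone _ hy
    have h1 : y - latticePoint g = ∑ i, c i • latticePoint ((M (κ g) * A⁻¹) i) := by
      apply rowMap_injective hdetA
      rw [map_sub, map_sum]
      simp only [map_smul, hrowR]
      rw [← hφκ, add_assoc] at hce
      rw [add_left_cancel hce]
      abel
    have hdet : IsUnit (M (κ g) * A⁻¹).det := by
      rw [Matrix.det_mul]
      exact (hM _ hg).1.det.mul (Matrix.isUnit_nonsing_inv_det A hdetA)
    rw [h1, map_sum]
    refine Finset.sum_nonneg fun j _ => ?_
    rw [map_smul, dualForm_row hdet]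
    split_ifs <;> simp [hc]
  · intro g hg
    obtain ⟨t, -, hm, ht⟩ := htop _ hg
    have htN : t = N := by
      have : (t : ℝ) * lam = N * lam := by linarith
      exact_mod_cast mul_right_cancel₀ hA2.ne' this
    change latticePoint v₀ + rowMap A (latticePoint g + _) ∈ P
    rw [map_add, map_smul, hrowR, ← add_assoc, hφκ, ← latticePoint_nsmul, ← latticePoint_add, ← htN]
    exact hm.1
  · intro g hg i hi
    obtain ⟨t, ht, hm⟩ := (hM _ hg).1.exists_nat_mem_extremePoints hP hg.1.1 i
    refine ⟨t, ht, ?_⟩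
    have h1 : κ (g + t • (M (κ g) * A⁻¹) i) = κ g + t • M (κ g) i := by
      simp only [hκ]
      rw [Matrix.add_vecMul, Matrix.smul_vecMul, hrow, add_assoc]
    change κ _ ∈ W
    rw [h1]
    refine ⟨hm, ?_⟩
    have h2 : l (latticePoint (M (κ g) i)) = 0 := by
      fin_cases i
      · exact (hM _ hg).2.1
      · exact (hM _ hg).2.2.1
      · exact absurd rfl hi
    rw [latticePoint_add, latticePoint_nsmul, map_add, map_smul, h2, hg.2]
    simp

/-! ### Assembling the cover from all unimodular tetrahedra with vertices in `P`. -/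

theorem mainTheorem5 (P : Set (Fin 3 → ℝ)) (hP : IsLatticePolytope P) (hdim : polytopeDim P = 3)
    (hsmooth : IsSmoothPolytope P) (hprism : IsPrismatoid P) :
    HasUnimodularCover P := by
  obtain ⟨v₀, A, N, V, b, hA, hdata⟩ := exists_prismData hP hdim hsmooth hprism
  set C : Set (Fin 4 → Fin 3 → ℤ) := {c | (∀ i, latticePoint (c i) ∈ P) ∧ IsUnit (tetraDet c)}
    with hC
  have hCfin : C.Finite :=
    (Set.Finite.pi fun _ : Fin 4 => finite_setOf_latticePoint_mem hP.isCompact.isBounded).subset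
      fun c hc i _ => hc.1 i
  refine ⟨tetra '' C, hCfin.image _, ?_, ?_⟩
  · rintro _ ⟨c, hc, rfl⟩
    exact ⟨c, hc.2, rfl⟩
  · apply Set.Subset.antisymm
    · rintro x ⟨_, ⟨c, hc, rfl⟩, hx⟩
      refine convexHull_min ?_ hP.convex hx
      rintro _ ⟨i, rfl⟩
      exact hc.1 i
    · intro x hx
      have hφ : latticePoint v₀ + rowMap A (fun i => dualForm A i (x - latticePoint v₀)) = x := by
        rw [rowMap_dualForm hA]; abel
      obtain ⟨c, hcP, hcdet, hcx⟩ := hdata.exists_unimodular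
        (y := fun i => dualForm A i (x - latticePoint v₀)) (by
          change latticePoint v₀ + rowMap A _ ∈ P
          rwa [hφ])
      refine ⟨_, ⟨fun i => v₀ + Matrix.vecMul (c i) A, ⟨fun i => ?_, ?_⟩, rfl⟩, ?_⟩
      · rw [latticePoint_add, ← rowMap_latticePoint]
        exact hcP i
      · have h1 : tetraDet (fun i => v₀ + Matrix.vecMul (c i) A) = tetraDet c * A.det := by
          rw [tetraDet, tetraDet, ← Matrix.det_mul]
          congr 1
          ext i j
          have : (Matrix.of fun i j : Fin 3 => c i.succ j - c 0 j) i = c i.succ - c 0 := rfl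
          rw [Matrix.mul_apply_eq_vecMul, this, Matrix.sub_vecMul]
          simp
        rw [h1]
        exact hcdet.mul hA
      · obtain ⟨w, hw, hw1, hwy⟩ := mem_tetra_iff.1 hcx
        refine mem_tetra_iff.2 ⟨w, hw, hw1, ?_⟩
        rw [← hφ, ← hwy, map_sum]
        simp only [map_smul, rowMap_latticePoint, latticePoint_add, smul_add,
          Finset.sum_add_distrib]
        rw [← Finset.sum_smul, hw1, one_smul]
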